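/- Let $k$ be a field and let $A$ be a bialgebra over $k$ (unadorned $\otimes$ and $\mathrm{Hom}$ are over $k$, $A^n$ denotes $A^{\otimes n}$, and Sweedler's notation is used). A skew antipode of $A$ is a $k$-linear map $T:A\to A$ with $\sum T(a_2)a_1=\varepsilon(a)1=\sum a_2T(a_1)$ for all $a\in A$. A left-right Hopf module over $A$ is a $k$-linear space $M$ that is a left $A$-module and a right $A$-comodule, $\rho_M(m)=\sum m_0\otimes m_1\in M\otimes A$, such that $\rho_M(a\cdot m)=\sum a_1\cdot m_0\otimes a_2m_1$ for all $a\in A$, $m\in M$. For left-right Hopf modules $M,N$ and $n,p\ge 0$ put $C^{n,p}(M,N)=\mathrm{Hom}(A^n\otimes M,\,N\otimes A^p)$ and write $f(x)=\sum f(x)^0\otimes f(x)^1\otimes\dots\otimes f(x)^p$. Define $d_m^{n,p}=\sum_{i=0}^{n+1}(-1)^ib_i:C^{n,p}\to C^{n+1,p}$ and $d_c^{n,p}=\sum_{i=0}^{p+1}(-1)^ic_i:C^{n,p}\to C^{n,p+1}$ by - $b_0(f)(a^1\otimes\dots\otimes a^{n+1}\otimes m)=\sum (a^1)_1\cdot f(y)^0\otimes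 (a^1)_2f(y)^1\otimes\dots\otimes(a^1)_{p+1}f(y)^p$, where $y=a^2\otimes\dots\otimes a^{n+1}\otimes m$; - $b_i(f)(a^1\otimes\dots\otimes a^{n+1}\otimes m)=f(a^1\otimes\dots\otimes a^ia^{i+1}\otimes\dots\otimes a^{n+1}\otimes m)$ for $1\le i\le n$; - $b_{n+1}(f)(a^1\otimes\dots\otimes a^{n+1}\otimes m)=f(a^1\otimes\dots\otimes a^n\otimes a^{n+1}\cdot m)$; - $c_0(f)=(\rho_N\otimes \mathrm{id}_{A^p})\circ f$; - $c_i(f)=(\mathrm{id}_N\otimes \mathrm{id}_A\otimes\dots\otimes\Delta\otimes\dots\otimes \mathrm{id}_A)\circ f$ for $1\le i\le p$, with $\Delta$ applied to the $i$-th factor of $A^p$; - $c_{p+1}(f)(a^1\otimes\dots\otimes a^n\otimes m)=\sum f((a^1)_1\otimes\dots\otimes(a^n)_1\otimes m_0)\otimes (a^1)_2\cdots(a^n)_2m_1$. These form a double complex $(C^{n,p}(M,N),d_m,d_c)$. Let $H^n(M,N)$, $n\ge 0$, be the cohomology of its total complex $\bigoplus_{i+j=n}C^{i,j}(M,N)$,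 with differential $d_m+(-1)^id_c$ on $C^{i,j}(M,N)$. Proposition. If $A$ has a skew antipode, then $H^n(M,N)=0$ for all left-right Hopf modules $M,N$ over $A$ and all $n\ge 1$. Moreover, every Hopf algebra over $k$ with bijective antipode has a skew antipode. -/

import Mathlib

open scoped TensorProduct

noncomputable section

namespace HopfModuleCohomology

section Basic

variable (k A : Type*) [Field k] [Ring A]

/-- A bialgebra `A` has a skew antipode: there is a linear map `T : A → A` with
`∑ T(a₂) a₁ = ε(a) 1 = ∑ a₂ T(a₁)` for all `a`. -/
def HasSkewAntipode [Bialgebra k A] : Prop :=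
  ∃ T : A →ₗ[k] A,
    (LinearMap.mul' k A ∘ₗ T.rTensor A ∘ₗ (TensorProduct.comm k A A).toLinearMap ∘ₗ
      Coalgebra.comul = Algebra.linearMap k A ∘ₗ Coalgebra.counit) ∧
    (LinearMap.mul' k A ∘ₗ T.lTensor A ∘ₗ (TensorProduct.comm k A A).toLinearMap ∘ₗ
      Coalgebra.comul = Algebra.linearMap k A ∘ₗ Coalgebra.counit)

/-- Right comodules over the coalgebra `A`. -/
class RightComodule (k A M : Type*) [Field k] [Ring A] [Bialgebra k A]
    [AddCommGroup M] [Module k M] where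
  /-- The coaction `ρ : M → M ⊗ A`, `ρ(m) = ∑ m₀ ⊗ m₁`. -/
  coact : M →ₗ[k] M ⊗[k] A
  /-- `(ρ ⊗ id) ∘ ρ = (id ⊗ Δ) ∘ ρ`. -/
  coassoc : (TensorProduct.assoc k M A A).toLinearMap ∘ₗ coact.rTensor A ∘ₗ coact =
    (Coalgebra.comul : A →ₗ[k] A ⊗[k] A).lTensor M ∘ₗ coact
  /-- `(id ⊗ ε) ∘ ρ = id`. -/
  counit_coact : (TensorProduct.rid k M).toLinearMap ∘ₗ
    (Coalgebra.counit : A →ₗ[k] k).lTensor M ∘ₗ coact = LinearMap.id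

/-- Left-right Hopf modules over the bialgebra `A`: left `A`-modules (with underlying `k`-linear
space `M`) that are right `A`-comodules, with
`∑ (a • m)₀ ⊗ (a • m)₁ = ∑ a₁ • m₀ ⊗ a₂ m₁`. -/
class IsHopfModule (k A M : Type*) [Field k] [Ring A] [Bialgebra k A]
    [AddCommGroup M] [Module k M] [Module A M] [IsScalarTower k A M] [RightComodule k A M] :
    Prop where
  coact_smul : ∀ (a : A) (m : M), (RightComodule.coact (a • m) : M ⊗[k] A) =
    TensorProduct.map₂ (Algebra.lsmul k k M).toLinearMap (LinearMap.mul k A)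
      (Coalgebra.comul a) (RightComodule.coact m)

end Basic

section TensorPowers

variable (k A : Type*) [Field k] [Ring A] [Bialgebra k A]

/-- `A ⊗ Aⁿ ≃ Aⁿ⁺¹`, `a ⊗ (a¹ ⊗ ⋯ ⊗ aⁿ) ↦ a ⊗ a¹ ⊗ ⋯ ⊗ aⁿ`. -/
def consEquiv (n : ℕ) : A ⊗[k] (⨂[k]^n A) ≃ₗ[k] ⨂[k]^(n + 1) A :=
  TensorProduct.congr (PiTensorProduct.subsingletonEquiv (R := k) (s := fun _ : Fin 1 => A) 0).symm (LinearEquiv.refl k _)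
    ≪≫ₗ TensorPower.mulEquiv ≪≫ₗ TensorPower.cast k A (Nat.add_comm 1 n)

/-- `Aⁿ ⊗ A ≃ Aⁿ⁺¹`, `(a¹ ⊗ ⋯ ⊗ aⁿ) ⊗ a ↦ a¹ ⊗ ⋯ ⊗ aⁿ ⊗ a`. -/
def snocEquiv (n : ℕ) : (⨂[k]^n A) ⊗[k] A ≃ₗ[k] ⨂[k]^(n + 1) A :=
  TensorProduct.congr (LinearEquiv.refl k _) (PiTensorProduct.subsingletonEquiv (R := k) (s := fun _ : Fin 1 => A) 0).symm
    ≪≫ₗ TensorPower.mulEquiv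

lemma consEquiv_tmul_tprod (n : ℕ) (a : A) (x : Fin n → A) :
    consEquiv k A n (a ⊗ₜ PiTensorProduct.tprod k x) = PiTensorProduct.tprod k (Fin.cons a x) := by
  rw [consEquiv]
  simp only [LinearEquiv.trans_apply, TensorProduct.congr_tmul, LinearEquiv.refl_apply,
    PiTensorProduct.subsingletonEquiv_symm_apply']
  rw [← TensorPower.gMul_def, TensorPower.tprod_mul_tprod, TensorPower.cast_tprod]
  congr 1
  funext i
  refine Fin.cases ?_ (fun j => ?_) i
  · have : Fin.cast (Nat.add_comm 1 n).symm 0 = Fin.castAdd n (0 : Fin 1) := rfl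
    simp [this]
  · have : Fin.cast (Nat.add_comm 1 n).symm j.succ = Fin.natAdd 1 j := by
      ext; simp [Nat.add_comm]
    simp [this]

lemma snocEquiv_tprod_tmul (n : ℕ) (a : A) (x : Fin n → A) :
    snocEquiv k A n (PiTensorProduct.tprod k x ⊗ₜ a) = PiTensorProduct.tprod k (Fin.snoc x a) := by
  rw [snocEquiv]
  simp only [LinearEquiv.trans_apply, TensorProduct.congr_tmul, LinearEquiv.refl_apply,
    PiTensorProduct.subsingletonEquiv_symm_apply']
  rw [← TensorPower.gMul_def, TensorPower.tprod_mul_tprod, Fin.append_right_eq_snoc]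

/-- `Aⁿ⁺¹ → Aⁿ` multiplying two neighbouring factors: for `i = 0, …, n - 1` it sends
`a⁰ ⊗ ⋯ ⊗ aⁿ` to `a⁰ ⊗ ⋯ ⊗ aⁱ aⁱ⁺¹ ⊗ ⋯ ⊗ aⁿ`. -/
def mulAt : (n : ℕ) → Fin n → (⨂[k]^(n + 1) A →ₗ[k] ⨂[k]^n A)
  | n + 1, ⟨0, _⟩ =>
      (consEquiv k A n).toLinearMap ∘ₗ (LinearMap.mul' k A).rTensor _ ∘ₗ
        (TensorProduct.assoc k A A (⨂[k]^n A)).symm.toLinearMap ∘ₗ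
        (consEquiv k A n).symm.toLinearMap.lTensor A ∘ₗ (consEquiv k A (n + 1)).symm.toLinearMap
  | n + 1, ⟨i + 1, h⟩ =>
      (consEquiv k A n).toLinearMap ∘ₗ
        (mulAt n ⟨i, Nat.lt_of_succ_lt_succ h⟩).lTensor A ∘ₗ
        (consEquiv k A (n + 1)).symm.toLinearMap

/-- `Aᵖ → Aᵖ⁺¹` comultiplying one factor: for `i = 0, …, p - 1` it sends
`a⁰ ⊗ ⋯ ⊗ aᵖ⁻¹` to `∑ a⁰ ⊗ ⋯ ⊗ (aⁱ)₁ ⊗ (aⁱ)₂ ⊗ ⋯ ⊗ aᵖ⁻¹`. -/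
def comulAt : (p : ℕ) → Fin p → (⨂[k]^p A →ₗ[k] ⨂[k]^(p + 1) A)
  | p + 1, ⟨0, _⟩ =>
      (consEquiv k A (p + 1)).toLinearMap ∘ₗ (consEquiv k A p).toLinearMap.lTensor A ∘ₗ
        (TensorProduct.assoc k A A (⨂[k]^p A)).toLinearMap ∘ₗ
        (Coalgebra.comul : A →ₗ[k] A ⊗[k] A).rTensor _ ∘ₗ (consEquiv k A p).symm.toLinearMap
  | p + 1, ⟨i + 1, h⟩ =>
      (consEquiv k A (p + 1)).toLinearMap ∘ₗ
        (comulAt p ⟨i, Nat.lt_of_succ_lt_succ h⟩).lTensor A ∘ₗ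
        (consEquiv k A p).symm.toLinearMap

/-- The iterated comultiplication `A → Aᵖ`, `a ↦ ∑ a₁ ⊗ ⋯ ⊗ aₚ` (the counit for `p = 0`). -/
def iterComul : (p : ℕ) → (A →ₗ[k] ⨂[k]^p A)
  | 0 => (PiTensorProduct.isEmptyEquiv (Fin 0)).symm.toLinearMap ∘ₗ Coalgebra.counit
  | p + 1 => (consEquiv k A p).toLinearMap ∘ₗ (iterComul p).lTensor A ∘ₗ Coalgebra.comul

/-- `Aⁿ → Aⁿ ⊗ A`,
`a¹ ⊗ ⋯ ⊗ aⁿ ↦ ∑ ((a¹)₁ ⊗ ⋯ ⊗ (aⁿ)₁) ⊗ (a¹)₂ ⋯ (aⁿ)₂`. -/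
def powCoact : (n : ℕ) → (⨂[k]^n A →ₗ[k] (⨂[k]^n A) ⊗[k] A)
  | 0 => (TensorProduct.mk k _ A).flip 1
  | n + 1 =>
      TensorProduct.map (consEquiv k A n).toLinearMap (LinearMap.mul' k A) ∘ₗ
        (TensorProduct.tensorTensorTensorComm k A A (⨂[k]^n A) A).toLinearMap ∘ₗ
        TensorProduct.map Coalgebra.comul (powCoact n) ∘ₗ (consEquiv k A n).symm.toLinearMap

end TensorPowers

section Complex

variable (k A M N : Type*) [Field k] [Ring A] [Bialgebra k A]
  [AddCommGroup M] [Module k M] [Module A M] [IsScalarTower k A M]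
  [RightComodule k A M]
  [AddCommGroup N] [Module k N] [Module A N] [IsScalarTower k A N]
  [RightComodule k A N]

/-- `Cⁿᵖ(M, N) = Hom(Aⁿ ⊗ M, N ⊗ Aᵖ)`. -/
abbrev Cochain (n p : ℕ) : Type _ := (⨂[k]^n A) ⊗[k] M →ₗ[k] N ⊗[k] (⨂[k]^p A)

/-- The diagonal action of `A` on `N ⊗ Aᵖ`:
`a ⊗ (x ⊗ c¹ ⊗ ⋯ ⊗ cᵖ) ↦ ∑ a₁ • x ⊗ a₂ c¹ ⊗ ⋯ ⊗ aₚ₊₁ cᵖ`. -/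
def diagAct (p : ℕ) : A ⊗[k] (N ⊗[k] (⨂[k]^p A)) →ₗ[k] N ⊗[k] (⨂[k]^p A) :=
  TensorProduct.lift (TensorProduct.map₂ (Algebra.lsmul k k N).toLinearMap
    (LinearMap.mul k (⨂[k]^p A)) ∘ₗ (iterComul k A p).lTensor A ∘ₗ Coalgebra.comul)

/-- `Aⁿ⁺¹ ⊗ M → Aⁿ ⊗ M`, `a¹ ⊗ ⋯ ⊗ aⁿ⁺¹ ⊗ m ↦ a¹ ⊗ ⋯ ⊗ aⁿ ⊗ aⁿ⁺¹ • m`. -/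
def actLast (n : ℕ) : (⨂[k]^(n + 1) A) ⊗[k] M →ₗ[k] (⨂[k]^n A) ⊗[k] M :=
  (TensorProduct.lift (Algebra.lsmul k k M).toLinearMap).lTensor _ ∘ₗ
    (TensorProduct.assoc k (⨂[k]^n A) A M).toLinearMap ∘ₗ
    (snocEquiv k A n).symm.toLinearMap.rTensor M

/-- `Aⁿ ⊗ M → (Aⁿ ⊗ M) ⊗ A`,
`a¹ ⊗ ⋯ ⊗ aⁿ ⊗ m ↦ ∑ ((a¹)₁ ⊗ ⋯ ⊗ (aⁿ)₁ ⊗ m₀) ⊗ (a¹)₂ ⋯ (aⁿ)₂ m₁`. -/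
def codiagCoact (n : ℕ) : (⨂[k]^n A) ⊗[k] M →ₗ[k] ((⨂[k]^n A) ⊗[k] M) ⊗[k] A :=
  (LinearMap.mul' k A).lTensor _ ∘ₗ
    (TensorProduct.tensorTensorTensorComm k (⨂[k]^n A) A M A).toLinearMap ∘ₗ
    TensorProduct.map (powCoact k A n) RightComodule.coact

/-- `N ⊗ Aᵖ → N ⊗ Aᵖ⁺¹`, `x ⊗ c¹ ⊗ ⋯ ⊗ cᵖ ↦ ∑ x₀ ⊗ x₁ ⊗ c¹ ⊗ ⋯ ⊗ cᵖ`. -/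
def coactFirst (p : ℕ) : N ⊗[k] (⨂[k]^p A) →ₗ[k] N ⊗[k] (⨂[k]^(p + 1) A) :=
  (consEquiv k A p).toLinearMap.lTensor N ∘ₗ
    (TensorProduct.assoc k N A (⨂[k]^p A)).toLinearMap ∘ₗ
    (RightComodule.coact : N →ₗ[k] N ⊗[k] A).rTensor _

/-- `b₀(f)(a¹ ⊗ ⋯ ⊗ aⁿ⁺¹ ⊗ m) = a¹ · f(a² ⊗ ⋯ ⊗ aⁿ⁺¹ ⊗ m)`, with the diagonal action. -/
def bFirst (n p : ℕ) : Cochain k A M N n p →ₗ[k] Cochain k A M N (n + 1) p :=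
  LinearMap.llcomp k _ _ _ (diagAct k A N p) ∘ₗ
    LinearMap.lcomp k _ ((TensorProduct.assoc k A (⨂[k]^n A) M).toLinearMap ∘ₗ
      (consEquiv k A n).symm.toLinearMap.rTensor M) ∘ₗ
    LinearMap.lTensorHom A

/-- `bᵢ₊₁(f)(a¹ ⊗ ⋯ ⊗ aⁿ⁺¹ ⊗ m) = f(a¹ ⊗ ⋯ ⊗ aⁱ⁺¹ aⁱ⁺² ⊗ ⋯ ⊗ aⁿ⁺¹ ⊗ m)`, `0 ≤ i < n`. -/
def bMid (n p : ℕ) (i : Fin n) : Cochain k A M N n p →ₗ[k] Cochain k A M N (n + 1) p :=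
  LinearMap.lcomp k _ ((mulAt k A n i).rTensor M)

/-- `bₙ₊₁(f)(a¹ ⊗ ⋯ ⊗ aⁿ⁺¹ ⊗ m) = f(a¹ ⊗ ⋯ ⊗ aⁿ ⊗ aⁿ⁺¹ • m)`. -/
def bLast (n p : ℕ) : Cochain k A M N n p →ₗ[k] Cochain k A M N (n + 1) p :=
  LinearMap.lcomp k _ (actLast k A M n)

/-- The horizontal differential `d_m = ∑ (-1)ⁱ bᵢ`, `i = 0, …, n + 1`. -/
def dm (n p : ℕ) : Cochain k A M N n p →ₗ[k] Cochain k A M N (n + 1) p :=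
  bFirst k A M N n p + ∑ i : Fin n, (-1 : k) ^ (i.val + 1) • bMid k A M N n p i +
    (-1 : k) ^ (n + 1) • bLast k A M N n p

/-- `c₀(f) = (ρ_N ⊗ id) ∘ f`. -/
def cFirst (n p : ℕ) : Cochain k A M N n p →ₗ[k] Cochain k A M N n (p + 1) :=
  LinearMap.llcomp k _ _ _ (coactFirst k A N p)

/-- `cᵢ₊₁(f) = (id_N ⊗ id ⊗ ⋯ ⊗ Δ ⊗ ⋯ ⊗ id) ∘ f`, with `Δ` on the factor `i + 1` of `Aᵖ`,
`0 ≤ i < p`. -/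
def cMid (n p : ℕ) (i : Fin p) : Cochain k A M N n p →ₗ[k] Cochain k A M N n (p + 1) :=
  LinearMap.llcomp k _ _ _ ((comulAt k A p i).lTensor N)

/-- `cₚ₊₁(f)(a¹ ⊗ ⋯ ⊗ aⁿ ⊗ m) =
∑ f((a¹)₁ ⊗ ⋯ ⊗ (aⁿ)₁ ⊗ m₀) ⊗ (a¹)₂ ⋯ (aⁿ)₂ m₁`. -/
def cLast (n p : ℕ) : Cochain k A M N n p →ₗ[k] Cochain k A M N n (p + 1) :=
  LinearMap.llcomp k _ _ _ ((snocEquiv k A p).toLinearMap.lTensor N ∘ₗ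
      (TensorProduct.assoc k N (⨂[k]^p A) A).toLinearMap) ∘ₗ
    LinearMap.lcomp k _ (codiagCoact k A M n) ∘ₗ
    LinearMap.rTensorHom A

/-- The vertical differential `d_c = ∑ (-1)ⁱ cᵢ`, `i = 0, …, p + 1`. -/
def dc (n p : ℕ) : Cochain k A M N n p →ₗ[k] Cochain k A M N n (p + 1) :=
  cFirst k A M N n p + ∑ i : Fin p, (-1 : k) ^ (i.val + 1) • cMid k A M N n p i +
    (-1 : k) ^ (p + 1) • cLast k A M N n p

/-- The total complex in degree `q`: the (finite) direct sum of all `Cⁿᵖ(M, N)` with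
`n + p = q`, as families indexed by the pairs `(n, p)`. -/
def Tot (q : ℕ) : Type _ :=
  ∀ e : {e : ℕ × ℕ // e.1 + e.2 = q}, Cochain k A M N e.1.1 e.1.2

instance (q : ℕ) : AddCommGroup (Tot k A M N q) :=
  inferInstanceAs (AddCommGroup (∀ e : {e : ℕ × ℕ // e.1 + e.2 = q}, Cochain k A M N e.1.1 e.1.2))

instance (q : ℕ) : Module k (Tot k A M N q) :=
  inferInstanceAs (Module k (∀ e : {e : ℕ × ℕ // e.1 + e.2 = q}, Cochain k A M N e.1.1 e.1.2))

/-- The contribution of `d_m` to the total differential. -/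
def totDm (q : ℕ) : Tot k A M N q →ₗ[k] Tot k A M N (q + 1) where
  toFun x
    | ⟨(0, _), _⟩ => 0
    | ⟨(n + 1, p), h⟩ => dm k A M N n p (x ⟨(n, p), by simp only at h ⊢; omega⟩)
  map_add' x y := by
    funext ⟨⟨n, p⟩, h⟩
    cases n with
    | zero => exact (add_zero 0).symm
    | succ n => exact map_add (dm k A M N n p) _ _
  map_smul' r x := by
    funext ⟨⟨n, p⟩, h⟩
    cases n with
    | zero => exact (smul_zero r).symm
    | succ n => exact map_smul (dm k A M N n p) _ _

/-- The contribution of `d_c` to the total differential, with the sign `(-1)ⁿ` on `Cⁿᵖ`. -/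
def totDc (q : ℕ) : Tot k A M N q →ₗ[k] Tot k A M N (q + 1) where
  toFun x
    | ⟨(_, 0), _⟩ => 0
    | ⟨(n, p + 1), h⟩ =>
      ((-1 : k) ^ n • dc k A M N n p) (x ⟨(n, p), by simp only at h ⊢; omega⟩)
  map_add' x y := by
    funext ⟨⟨n, p⟩, h⟩
    cases p with
    | zero => exact (add_zero 0).symm
    | succ p => exact map_add ((-1 : k) ^ n • dc k A M N n p) _ _
  map_smul' r x := by
    funext ⟨⟨n, p⟩, h⟩
    cases p with
    | zero => exact (smul_zero r).symm
    | succ p => exact map_smul ((-1 : k) ^ n • dc k A M N n p) _ _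

/-- The total differential: `d_m + (-1)ⁿ d_c` on `Cⁿᵖ(M, N)`. -/
def totD (q : ℕ) : Tot k A M N q →ₗ[k] Tot k A M N (q + 1) := totDm k A M N q + totDc k A M N q

/-- The cocycles of the total complex. -/
def cocycles (q : ℕ) : Submodule k (Tot k A M N q) := LinearMap.ker (totD k A M N q)

/-- The coboundaries of the total complex. -/
def coboundaries : (q : ℕ) → Submodule k (Tot k A M N q)
  | 0 => ⊥
  | q + 1 => LinearMap.range (totD k A M N q)

/-- `Hⁿ(M, N)`: the cohomology in degree `n` of the total complex. -/
abbrev Cohomology (n : ℕ) : Type _ :=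
  cocycles k A M N n ⧸ (coboundaries k A M N n).submoduleOf (cocycles k A M N n)

end Complex

end HopfModuleCohomology

end

/-! The skew antipode `T` gives every Hopf module the linear map e(m) = ∑ T(m₁) m₀. It takes
coinvariant values, satisfies e(a m) = ε(a) e(m), and recovers the module through m = ∑ m₁ e(m₀)
(`exists_isCoinvProj`). Two structure maps follow. On M, the map m ↦ ∑ m₁ ⊗ e(m₀) is an A-linear and
colinear section of the action A ⊗ M → M. On N, the map x ⊗ a ↦ a e(x) is an A-linear and colinear
retraction of the coaction N → N ⊗ A.

Postcomposition with the retraction gives s : Cⁿᵖ⁺¹ → Cⁿᵖ, which commutes with d_m (`retractHom_dm`)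
and satisfies s d_c + d_c s = id when the source has p ≥ 1 (`retractHom_dc_succ`). For p = 0 it
gives s d_c = id - π (`retractHom_dc_zero`), where π projects to colinear maps, so d_c π = 0
(`dc_colinearProj`) and π d_m = d_m π (`dm_colinearProj`). Columns are thus contracted onto the row
of colinear maps.

Precomposition with the section gives t : Cⁿ⁺¹ᵖ → Cⁿᵖ with t d_m = d_m t + (-1)ⁿ on Cⁿ⁺¹ᵖ
(`splitHom_dm_succ`). It preserves colinear maps (`splitHom_dc`), so it contracts that remaining row
in positive degrees. A cocycle x then has a primitive built from s applied to its components with p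
≥ 1, with correction t π applied to its component with p = 0 (`totD_totPrimitive`).

For a bijective antipode S, the map S⁻¹ is a skew antipode because S reverses products. -/

noncomputable section

namespace HopfModuleCohomology

/-! ### Right coactions, convolution along a coaction, and the tensor coaction on A ⊗ X. -/

section Coactions

variable {k A : Type*} [Field k] [Ring A] [Bialgebra k A]
variable {X Y V W : Type*} [AddCommGroup X] [Module k X] [AddCommGroup Y] [Module k Y]
  [AddCommGroup V] [Module k V] [AddCommGroup W] [Module k W]

/-- The axioms of a right coaction, for a linear map `r : X → X ⊗ A`. -/
structure IsCoaction (r : X →ₗ[k] X ⊗[k] A) : Prop where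
  coassoc : ∀ x, TensorProduct.assoc k X A A (r.rTensor A (r x)) =
    (Coalgebra.comul : A →ₗ[k] A ⊗[k] A).lTensor X (r x)
  counit : ∀ x, TensorProduct.rid k X ((Coalgebra.counit : A →ₗ[k] k).lTensor X (r x)) = x

/-- Colinear maps between spaces with coactions `r` and `s`. -/
def IsColinear (r : X →ₗ[k] X ⊗[k] A) (s : Y →ₗ[k] Y ⊗[k] A) (f : X →ₗ[k] Y) : Prop :=
  ∀ x, s (f x) = f.rTensor A (r x)

lemma IsCoaction.of_equiv {r : X →ₗ[k] X ⊗[k] A} {s : Y →ₗ[k] Y ⊗[k] A} (hr : IsCoaction r)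
    (e : X ≃ₗ[k] Y) (he : IsColinear r s e.toLinearMap) : IsCoaction s := by
  constructor
  · intro y
    obtain ⟨x, rfl⟩ := e.surjective y
    have h1 := congrArg (e.toLinearMap.rTensor (A ⊗[k] A)) (hr.coassoc x)
    have h2 := he x
    simp only [LinearEquiv.coe_coe] at h2
    rw [h2]
    have a1 : ∀ z : X ⊗[k] A, TensorProduct.assoc k Y A A (s.rTensor A (e.toLinearMap.rTensor A z)) =
        e.toLinearMap.rTensor (A ⊗[k] A) (TensorProduct.assoc k X A A (r.rTensor A z)) := by
      intro z
      induction z with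
      | zero => simp
      | add a b ha hb => simp only [map_add, ha, hb]
      | tmul x a =>
        have h3 := he x
        simp only [LinearEquiv.coe_coe] at h3
        simp only [LinearMap.rTensor_tmul, LinearEquiv.coe_coe, h3]
        generalize r x = w
        induction w with
        | zero => simp
        | add a b ha hb => simp only [map_add, TensorProduct.add_tmul, ha, hb]
        | tmul x b => simp
    have a2 : ∀ z : X ⊗[k] A, (Coalgebra.comul : A →ₗ[k] A ⊗[k] A).lTensor Y
        (e.toLinearMap.rTensor A z) = e.toLinearMap.rTensor (A ⊗[k] A)
          ((Coalgebra.comul : A →ₗ[k] A ⊗[k] A).lTensor X z) := by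
      intro z
      induction z with
      | zero => simp
      | add a b ha hb => simp only [map_add, ha, hb]
      | tmul x a => simp
    rw [a1, a2, h1]
  · intro y
    obtain ⟨x, rfl⟩ := e.surjective y
    have h2 := he x
    simp only [LinearEquiv.coe_coe] at h2
    rw [h2]
    conv_rhs => rw [← hr.counit x]
    generalize r x = z
    induction z with
    | zero => simp
    | add a b ha hb => simp only [map_add, ha, hb]
    | tmul x a => simp

/-- For a coaction `r`, an action `α`, `φ : A → A` and `F : X → V`, the map
`x ↦ ∑ φ(x₁) F(x₀)`. -/
def convAct (α : A →ₐ[k] Module.End k V) (r : X →ₗ[k] X ⊗[k] A) (φ : A →ₗ[k] A)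
    (F : X →ₗ[k] V) : X →ₗ[k] V :=
  TensorProduct.lift ((α.toLinearMap ∘ₗ φ).flip ∘ₗ F) ∘ₗ r

lemma convAct_apply (α : A →ₐ[k] Module.End k V) (r : X →ₗ[k] X ⊗[k] A) (φ : A →ₗ[k] A)
    (F : X →ₗ[k] V) (x : X) :
    convAct α r φ F x = TensorProduct.lift ((α.toLinearMap ∘ₗ φ).flip ∘ₗ F) (r x) := rfl

/-- By coassociativity the composite is x ↦ ∑ φ(x₂) ψ(x₁) F(x₀). The reversed order of x₁ and x₂ is
the one in the skew antipode identities, so φ = T, ψ = id (or the opposite choice) collapses to the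
counit. -/
lemma convAct_convAct (α : A →ₐ[k] Module.End k V) {r : X →ₗ[k] X ⊗[k] A} (hr : IsCoaction r)
    (φ ψ : A →ₗ[k] A) (F : X →ₗ[k] V) :
    convAct α r φ (convAct α r ψ F) = convAct α r (LinearMap.mul' k A ∘ₗ
      TensorProduct.map φ ψ ∘ₗ (TensorProduct.comm k A A).toLinearMap ∘ₗ Coalgebra.comul) F := by
  -- Θ sends x ⊗ (b ⊗ c) to φ(c) ψ(b) F(x). The two composites are Θ applied to the two sides of
  -- coassociativity.
  let Θ : X ⊗[k] (A ⊗[k] A) →ₗ[k] V :=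
    TensorProduct.lift ((α.toLinearMap ∘ₗ LinearMap.mul' k A ∘ₗ TensorProduct.map φ ψ ∘ₗ
      (TensorProduct.comm k A A).toLinearMap).flip ∘ₗ F)
  ext x
  trans Θ (TensorProduct.assoc k X A A (r.rTensor A (r x)))
  · rw [convAct_apply]
    generalize r x = z
    induction z with
    | zero => simp
    | add a b ha hb => simp only [map_add, ha, hb]
    | tmul x c =>
      simp only [TensorProduct.lift.tmul, LinearMap.coe_comp, Function.comp_apply,
        LinearMap.flip_apply, convAct_apply, LinearMap.rTensor_tmul, AlgHom.toLinearMap_apply]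
      generalize r x = w
      induction w with
      | zero => simp
      | add a b ha hb => simp only [map_add, TensorProduct.add_tmul, ha, hb]
      | tmul x b => simp [Θ]
  · rw [hr.coassoc, convAct_apply]
    generalize r x = z
    induction z with
    | zero => simp
    | add a b ha hb => simp only [map_add, ha, hb]
    | tmul x c => simp [Θ]

lemma convAct_counit (α : A →ₐ[k] Module.End k V) {r : X →ₗ[k] X ⊗[k] A} (hr : IsCoaction r)
    (F : X →ₗ[k] V) :
    convAct α r (Algebra.linearMap k A ∘ₗ Coalgebra.counit) F = F := by
  ext x
  conv_rhs => rw [← hr.counit x]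
  rw [convAct_apply]
  generalize r x = z
  induction z with
  | zero => simp
  | add a b ha hb => simp only [map_add, ha, hb]
  | tmul x c => simp [Algebra.algebraMap_eq_smul_one]

/-- If `∑ T(a₂) a₁ = ε(a) 1`, then a map `F` is determined by `x ↦ ∑ x₁ F(x₀)`. -/
lemma convAct_id_injective (α : A →ₐ[k] Module.End k V) {r : X →ₗ[k] X ⊗[k] A}
    (hr : IsCoaction r) {T : A →ₗ[k] A}
    (hT : LinearMap.mul' k A ∘ₗ T.rTensor A ∘ₗ (TensorProduct.comm k A A).toLinearMap ∘ₗ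
      Coalgebra.comul = Algebra.linearMap k A ∘ₗ Coalgebra.counit)
    {F G : X →ₗ[k] V} (h : convAct α r LinearMap.id F = convAct α r LinearMap.id G) : F = G := by
  have h1 := congrArg (convAct α r T) h
  rw [convAct_convAct α hr, convAct_convAct α hr] at h1
  change convAct α r (LinearMap.mul' k A ∘ₗ T.rTensor A ∘ₗ _) F =
    convAct α r (LinearMap.mul' k A ∘ₗ T.rTensor A ∘ₗ _) G at h1
  rwa [hT, convAct_counit α hr, convAct_counit α hr] at h1

lemma convAct_comp (α : A →ₐ[k] Module.End k V) (β : A →ₐ[k] Module.End k W)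
    (r : X →ₗ[k] X ⊗[k] A) (φ : A →ₗ[k] A) (F : X →ₗ[k] V) (L : V →ₗ[k] W)
    (hL : ∀ a v, L (α a v) = β a (L v)) :
    convAct β r φ (L ∘ₗ F) = L ∘ₗ convAct α r φ F := by
  ext x
  rw [convAct_apply, LinearMap.comp_apply, convAct_apply]
  generalize r x = z
  induction z with
  | zero => simp
  | add a b ha hb => simp only [map_add, ha, hb]
  | tmul x c => simp [hL]

/-- The coaction `a ⊗ u ↦ ∑ (a₁ ⊗ u₀) ⊗ a₂ u₁` on `A ⊗ U`. -/
def tensorCoact (r : X →ₗ[k] X ⊗[k] A) : A ⊗[k] X →ₗ[k] (A ⊗[k] X) ⊗[k] A :=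
  (LinearMap.mul' k A).lTensor _ ∘ₗ
    (TensorProduct.tensorTensorTensorComm k A A X A).toLinearMap ∘ₗ
    TensorProduct.map Coalgebra.comul r

lemma tensorCoact_tmul (r : X →ₗ[k] X ⊗[k] A) (a : A) (x : X) :
    tensorCoact r (a ⊗ₜ x) = (LinearMap.mul' k A).lTensor _
      (TensorProduct.tensorTensorTensorComm k A A X A (Coalgebra.comul a ⊗ₜ[k] r x)) := rfl

lemma IsColinear.lTensor {r : X →ₗ[k] X ⊗[k] A} {s : Y →ₗ[k] Y ⊗[k] A} {f : X →ₗ[k] Y}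
    (hf : IsColinear r s f) : IsColinear (tensorCoact r) (tensorCoact s) (f.lTensor A) := by
  intro z
  induction z with
  | zero => simp
  | add a b ha hb => simp only [map_add, ha, hb]
  | tmul a x =>
    simp only [LinearMap.lTensor_tmul, tensorCoact_tmul, hf x]
    generalize r x = w
    generalize (Coalgebra.comul a : A ⊗[k] A) = v
    induction w with
    | zero => simp
    | add a b ha hb => simp only [map_add, TensorProduct.tmul_add, ha, hb]
    | tmul x b =>
      induction v with
      | zero => simp
      | add a b ha hb => simp only [map_add, TensorProduct.add_tmul, ha, hb]
      | tmul c d => simp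

/-- Multiplicativity of Δ and ε combines the coaction axioms on A and on X into those on A ⊗ X. -/
lemma IsCoaction.tensorCoact {r : X →ₗ[k] X ⊗[k] A} (hr : IsCoaction r) :
    IsCoaction (tensorCoact r) := by
  constructor
  · intro z
    induction z with
    | zero => simp
    | add a b ha hb => simp only [map_add, ha, hb]
    | tmul a x =>
      -- Ψ shuffles factors and multiplies in A ⊗ A, so coassociativity can be used on each tensor
      -- factor before they are combined.
      let Ψ : (A ⊗[k] (A ⊗[k] A)) ⊗[k] (X ⊗[k] (A ⊗[k] A)) →ₗ[k] (A ⊗[k] X) ⊗[k] (A ⊗[k] A) :=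
        (LinearMap.mul' k (A ⊗[k] A)).lTensor _ ∘ₗ
          (TensorProduct.tensorTensorTensorComm k A (A ⊗[k] A) X (A ⊗[k] A)).toLinearMap
      trans Ψ (TensorProduct.assoc k A A A (Coalgebra.comul.rTensor A (Coalgebra.comul a)) ⊗ₜ
        TensorProduct.assoc k X A A (r.rTensor A (r x)))
      · rw [tensorCoact_tmul]
        generalize r x = w
        generalize (Coalgebra.comul a : A ⊗[k] A) = v
        induction w with
        | zero => simp
        | add a b ha hb => simp only [map_add, TensorProduct.tmul_add, ha, hb]
        | tmul x b =>
          induction v with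
          | zero => simp
          | add a b ha hb => simp only [map_add, TensorProduct.add_tmul, ha, hb]
          | tmul c d =>
            simp only [TensorProduct.tensorTensorTensorComm_tmul, LinearMap.lTensor_tmul,
              LinearMap.rTensor_tmul, tensorCoact_tmul, LinearMap.mul'_apply]
            generalize r x = w
            generalize (Coalgebra.comul c : A ⊗[k] A) = v
            induction w with
            | zero => simp
            | add a b ha hb => simp only [map_add, TensorProduct.tmul_add, TensorProduct.add_tmul, ha, hb]
            | tmul x b =>
              induction v with
              | zero => simp
              | add a b ha hb => simp only [map_add, TensorProduct.add_tmul, ha, hb]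
              | tmul c d => simp [Ψ]
      · rw [hr.coassoc, Coalgebra.coassoc_apply, tensorCoact_tmul]
        generalize r x = w
        generalize (Coalgebra.comul a : A ⊗[k] A) = v
        induction w with
        | zero => simp
        | add a b ha hb => simp only [map_add, TensorProduct.tmul_add, ha, hb]
        | tmul x b =>
          induction v with
          | zero => simp
          | add a b ha hb => simp only [map_add, TensorProduct.add_tmul, ha, hb]
          | tmul c d => simp [Ψ]
  · intro z
    induction z with
    | zero => simp
    | add a b ha hb => simp only [map_add, ha, hb]
    | tmul a x =>
      rw [tensorCoact_tmul]
      conv_rhs => rw [← hr.counit x, ← (TensorProduct.rid k A).apply_symm_apply a,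
        TensorProduct.rid_symm_apply, ← Coalgebra.lTensor_counit_comul]
      generalize r x = w
      generalize (Coalgebra.comul a : A ⊗[k] A) = v
      induction w with
      | zero => simp
      | add a b ha hb => simp only [map_add, TensorProduct.tmul_add, ha, hb]
      | tmul x b =>
        induction v with
        | zero => simp
        | add a b ha hb => simp only [map_add, TensorProduct.add_tmul, ha, hb]
        | tmul c d =>
          simp [TensorProduct.smul_tmul', TensorProduct.tmul_smul, mul_smul]
          rw [smul_comm]

end Coactions

/-! ### The projection to coinvariants and the resulting section and retraction. -/

section Coinvariants

lemma RightComodule.isCoaction {k A M : Type*} [Field k] [Ring A] [Bialgebra k A]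
    [AddCommGroup M] [Module k M] [RightComodule k A M] :
    IsCoaction (RightComodule.coact : M →ₗ[k] M ⊗[k] A) :=
  ⟨fun x => LinearMap.congr_fun RightComodule.coassoc x,
    fun x => LinearMap.congr_fun RightComodule.counit_coact x⟩

variable {k A : Type*} [Field k] [Ring A] [Bialgebra k A]
variable {M : Type*} [AddCommGroup M] [Module k M] [Module A M] [IsScalarTower k A M]

/-- The diagonal action of `A` on `M ⊗ A`. -/
def diagEnd (k A M : Type*) [Field k] [Ring A] [Bialgebra k A] [AddCommGroup M] [Module k M]
    [Module A M] [IsScalarTower k A M] : A →ₐ[k] Module.End k (M ⊗[k] A) :=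
  (Module.endTensorEndAlgHom (R := k) (S := k) (A := k) (M := M) (N := A)).comp
    ((Algebra.TensorProduct.map (Algebra.lsmul k k M) (Algebra.lmul k A)).comp
      (Bialgebra.comulAlgHom k A))

/-- The algebra-homomorphism form fits `convAct`; the bilinear form matches
`IsHopfModule.coact_smul`. -/
lemma diagEnd_apply (a : A) (z : M ⊗[k] A) : diagEnd k A M a z =
    TensorProduct.map₂ (Algebra.lsmul k k M).toLinearMap (LinearMap.mul k A)
      (Coalgebra.comul a) z := by
  have : diagEnd k A M a = Module.endTensorEndAlgHom (R := k) (S := k) (A := k)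
    (Algebra.TensorProduct.map (Algebra.lsmul k k M) (Algebra.lmul k A) (Coalgebra.comul a)) := rfl
  rw [this]
  generalize (Coalgebra.comul a : A ⊗[k] A) = v
  induction v with
  | zero => simp
  | add a b ha hb => simp only [map_add, LinearMap.add_apply, ha, hb]
  | tmul c d =>
    induction z with
    | zero => simp
    | add a b ha hb => simp only [map_add, ha, hb]
    | tmul x b => simp [Module.endTensorEndAlgHom_apply]

/-- The map `n ⊗ a ↦ a e(n)`. -/
def coinvRetract (e : M →ₗ[k] M) : M ⊗[k] A →ₗ[k] M :=
  TensorProduct.lift ((Algebra.lsmul k k M (A := A)).toLinearMap.flip ∘ₗ e)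

lemma coinvRetract_tmul (e : M →ₗ[k] M) (m : M) (a : A) :
    coinvRetract e (m ⊗ₜ[k] a) = a • e m := by
  simp [coinvRetract]

variable [RightComodule k A M]

/-- The map `m ↦ ∑ m₁ ⊗ e(m₀)`. -/
def coinvSplit (e : M →ₗ[k] M) : M →ₗ[k] A ⊗[k] M :=
  (TensorProduct.comm k M A).toLinearMap ∘ₗ e.rTensor A ∘ₗ RightComodule.coact

/-- A linear projection of a Hopf module to its coinvariants which kills the augmentation ideal and
satisfies `m = ∑ m₁ e(m₀)`. -/
structure IsCoinvProj (e : M →ₗ[k] M) : Prop where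
  map_smul : ∀ (a : A) (m : M), e (a • m) = (Coalgebra.counit a : k) • e m
  coact_apply : ∀ m, (RightComodule.coact (e m) : M ⊗[k] A) = e m ⊗ₜ 1
  smul_split : ∀ m, TensorProduct.lift (Algebra.lsmul k k M).toLinearMap
    (coinvSplit (A := A) e m) = m

lemma convAct_id_eq (e : M →ₗ[k] M) (m : M) :
    convAct (Algebra.lsmul k k M) (RightComodule.coact : M →ₗ[k] M ⊗[k] A) LinearMap.id e m =
      TensorProduct.lift (Algebra.lsmul k k M).toLinearMap (coinvSplit (A := A) e m) := by
  simp only [convAct_apply, coinvSplit, LinearMap.comp_apply]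
  generalize (RightComodule.coact m : M ⊗[k] A) = w
  induction w with
  | zero => simp
  | add a b ha hb => simp only [map_add, ha, hb]
  | tmul x b => simp

/-- The witness is e(m) = ∑ T(m₁) m₀. The identity ∑ a₂ T(a₁) = ε(a) gives the reconstruction
formula. The identity ∑ T(a₂) a₁ = ε(a) makes convolution with the identity injective, so the other
two properties may be checked after convolving, where reconstruction applies. -/
lemma exists_isCoinvProj [IsHopfModule k A M] (h : HasSkewAntipode k A) :
    ∃ e : M →ₗ[k] M, IsCoinvProj (A := A) e := by
  obtain ⟨T, hT1, hT2⟩ := h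
  let ρ : M →ₗ[k] M ⊗[k] A := RightComodule.coact
  have hρ : IsCoaction ρ := RightComodule.isCoaction
  let α := Algebra.lsmul k k M (A := A)
  let e : M →ₗ[k] M := convAct α ρ T LinearMap.id
  have h3 : convAct α ρ LinearMap.id e = LinearMap.id := by
    rw [convAct_convAct α hρ]
    change convAct α ρ (LinearMap.mul' k A ∘ₗ T.lTensor A ∘ₗ _) _ = _
    rw [hT2, convAct_counit α hρ]
  refine ⟨e, ?_, ?_, ?_⟩
  -- Both maps A ⊗ M → M convolve to a ⊗ m ↦ a m: one by reconstruction of a m, the other by the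
  -- counit and reconstruction of m.
  · have key : e ∘ₗ TensorProduct.lift α.toLinearMap =
        TensorProduct.lift ((LinearMap.lsmul k (M →ₗ[k] M)).flip e ∘ₗ
          (Coalgebra.counit : A →ₗ[k] k)) := by
      refine convAct_id_injective α hρ.tensorCoact hT1 ?_
      refine TensorProduct.ext' fun a m => ?_
      trans a • m
      · conv_rhs => rw [← LinearMap.id_apply (R := k) (a • m), ← h3]
        rw [convAct_apply, convAct_apply]
        have : ρ (a • m) = _ := IsHopfModule.coact_smul a m
        rw [this, tensorCoact_tmul]
        change _ = TensorProduct.lift _ (TensorProduct.map₂ _ _ _ (ρ m))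
        generalize ρ m = w
        generalize (Coalgebra.comul a : A ⊗[k] A) = v
        induction w with
        | zero => simp
        | add a b ha hb => simp only [map_add, TensorProduct.tmul_add, ha, hb]
        | tmul x b =>
          induction v with
          | zero => simp
          | add a b ha hb => simp only [map_add, TensorProduct.add_tmul, LinearMap.add_apply, ha, hb]
          | tmul c d => simp [α]
      · conv_lhs => rw [← LinearMap.id_apply (R := k) m, ← h3]
        conv_lhs => enter [1]; rw [← (TensorProduct.lid k A).apply_symm_apply a,
          TensorProduct.lid_symm_apply, ← Coalgebra.rTensor_counit_comul]
        rw [convAct_apply, convAct_apply, tensorCoact_tmul]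
        generalize ρ m = w
        generalize (Coalgebra.comul a : A ⊗[k] A) = v
        induction w with
        | zero => simp
        | add a b ha hb => simp only [map_add, smul_add, TensorProduct.tmul_add, ha, hb]
        | tmul x b =>
          induction v with
          | zero => simp
          | add a b ha hb => simp only [map_add, add_smul, TensorProduct.add_tmul, ha, hb]
          | tmul c d => simp [α]
    intro a m
    simpa [α] using LinearMap.congr_fun key (a ⊗ₜ m)
  -- For the diagonal action on M ⊗ A, both sides convolve to ρ: the left because ρ is A-linear, the
  -- right because ∑ m₁ e(m₀) ⊗ m₂ = ρ(m).
  · have key : ρ ∘ₗ e = (TensorProduct.mk k M A).flip 1 ∘ₗ e := by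
      refine convAct_id_injective (diagEnd k A M) hρ hT1 ?_
      rw [convAct_comp α (diagEnd k A M) ρ LinearMap.id e ρ, h3]
      · ext m
        have h4 : ρ m = (convAct α ρ LinearMap.id e).rTensor A (ρ m) := by rw [h3]; simp
        let Θ : M ⊗[k] (A ⊗[k] A) →ₗ[k] M ⊗[k] A :=
          (TensorProduct.lift α.toLinearMap.flip).rTensor A ∘ₗ
            (TensorProduct.assoc k M A A).symm.toLinearMap ∘ₗ e.rTensor (A ⊗[k] A)
        trans Θ (TensorProduct.assoc k M A A (ρ.rTensor A (ρ m)))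
        · simp only [LinearMap.comp_id]
          conv_lhs => rw [h4]
          generalize ρ m = w
          induction w with
          | zero => simp
          | add a b ha hb => simp only [map_add, ha, hb]
          | tmul x b =>
            simp only [LinearMap.rTensor_tmul, convAct_apply]
            generalize ρ x = w
            induction w with
            | zero => simp
            | add a b ha hb => simp only [map_add, TensorProduct.add_tmul, ha, hb]
            | tmul x b => simp [Θ]
        · rw [hρ.coassoc, convAct_apply]
          generalize ρ m = w
          induction w with
          | zero => simp
          | add a b ha hb => simp only [map_add, ha, hb]
          | tmul x b =>
            simp only [LinearMap.lTensor_tmul, TensorProduct.lift.tmul, LinearMap.comp_apply,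
              LinearMap.flip_apply, AlgHom.toLinearMap_apply, diagEnd_apply, LinearMap.id_apply,
              TensorProduct.mk_apply]
            generalize (Coalgebra.comul b : A ⊗[k] A) = v
            induction v with
            | zero => simp
            | add a b ha hb =>
              simp only [map_add, TensorProduct.tmul_add, LinearMap.add_apply, ha, hb]
            | tmul c d => simp [Θ, α]
      · intro a m
        rw [diagEnd_apply]
        exact IsHopfModule.coact_smul a m
    intro m
    simpa using LinearMap.congr_fun key m
  · intro m
    rw [← convAct_id_eq]
    exact LinearMap.congr_fun h3 m

variable {e : M →ₗ[k] M}

/-- In ∑ a₂ m₁ ⊗ e(a₁ m₀) the factor a₁ becomes ε(a₁), leaving a in front. -/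
lemma coinvSplit_smul [IsHopfModule k A M] (he : IsCoinvProj (A := A) e) (a : A) (m : M) :
    coinvSplit e (a • m) = (LinearMap.mulLeft k a).rTensor M (coinvSplit e m) := by
  simp only [coinvSplit, LinearMap.comp_apply]
  rw [IsHopfModule.coact_smul a m]
  conv_rhs => rw [← (TensorProduct.lid k A).apply_symm_apply a,
          TensorProduct.lid_symm_apply, ← Coalgebra.rTensor_counit_comul]
  generalize (RightComodule.coact m : M ⊗[k] A) = w
  generalize (Coalgebra.comul a : A ⊗[k] A) = v
  induction w with
  | zero => simp
  | add a b ha hb => simp only [map_add, ha, hb]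
  | tmul x b =>
    induction v with
    | zero => simp
    | add a b ha hb =>
      simp only [map_add, LinearMap.add_apply, LinearEquiv.coe_coe, LinearMap.rTensor_tmul,
        TensorProduct.comm_tmul, LinearMap.mulLeft_apply, add_mul, TensorProduct.add_tmul] at ha hb ⊢
      rw [ha, hb]
    | tmul c d => simp [he.map_smul, TensorProduct.smul_tmul']

/-- Since e(m₀) is coinvariant, only m₁ is comultiplied; coassociativity of ρ does the rest. -/
lemma isColinear_coinvSplit (he : IsCoinvProj (A := A) e) :
    IsColinear (RightComodule.coact : M →ₗ[k] M ⊗[k] A) (tensorCoact RightComodule.coact)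
      (coinvSplit (A := A) e) := by
  intro m
  let Θ : M ⊗[k] (A ⊗[k] A) →ₗ[k] (A ⊗[k] M) ⊗[k] A :=
    (TensorProduct.comm k M A).toLinearMap.rTensor A ∘ₗ
      (TensorProduct.assoc k M A A).symm.toLinearMap ∘ₗ e.rTensor (A ⊗[k] A)
  trans Θ (TensorProduct.assoc k M A A
    ((RightComodule.coact : M →ₗ[k] M ⊗[k] A).rTensor A (RightComodule.coact m)))
  · rw [RightComodule.isCoaction.coassoc]
    simp only [coinvSplit, LinearMap.comp_apply]
    generalize (RightComodule.coact m : M ⊗[k] A) = w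
    induction w with
    | zero => simp
    | add a b ha hb => simp only [map_add, ha, hb]
    | tmul x b =>
      simp only [LinearMap.rTensor_tmul, LinearMap.lTensor_tmul, LinearEquiv.coe_coe,
        TensorProduct.comm_tmul, tensorCoact_tmul, he.coact_apply]
      generalize (Coalgebra.comul b : A ⊗[k] A) = v
      induction v with
      | zero => simp
      | add a b ha hb => simp only [map_add, TensorProduct.tmul_add, TensorProduct.add_tmul, ha, hb]
      | tmul c d => simp [Θ]
  · generalize (RightComodule.coact m : M ⊗[k] A) = w
    induction w with
    | zero => simp
    | add a b ha hb => simp only [map_add, ha, hb]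
    | tmul x b =>
      simp only [LinearMap.rTensor_tmul, coinvSplit, LinearMap.comp_apply]
      generalize (RightComodule.coact x : M ⊗[k] A) = w
      induction w with
      | zero => simp
      | add a b ha hb => simp only [map_add, TensorProduct.add_tmul, ha, hb]
      | tmul x b => simp [Θ]

lemma coinvRetract_coact (he : IsCoinvProj (A := A) e) (m : M) :
    coinvRetract e (RightComodule.coact m : M ⊗[k] A) = m := by
  conv_rhs => rw [← he.smul_split m]
  simp only [coinvSplit, LinearMap.comp_apply]
  generalize (RightComodule.coact m : M ⊗[k] A) = w
  induction w with
  | zero => simp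
  | add a b ha hb => simp only [map_add, ha, hb]
  | tmul x b => simp [coinvRetract_tmul]

/-- For coinvariant e(x), ρ(b e(x)) = ∑ b₁ e(x) ⊗ b₂. This is colinearity of the retraction when M ⊗
A carries the coaction id ⊗ Δ. -/
lemma coact_coinvRetract [IsHopfModule k A M] (he : IsCoinvProj (A := A) e) (z : M ⊗[k] A) :
    (RightComodule.coact (coinvRetract e z) : M ⊗[k] A) =
      (coinvRetract e).rTensor A ((TensorProduct.assoc k M A A).symm
        ((Coalgebra.comul : A →ₗ[k] A ⊗[k] A).lTensor M z)) := by
  induction z with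
  | zero => simp
  | add a b ha hb => simp only [map_add, ha, hb]
  | tmul x b =>
    rw [coinvRetract_tmul, IsHopfModule.coact_smul, he.coact_apply, LinearMap.lTensor_tmul]
    generalize (Coalgebra.comul b : A ⊗[k] A) = v
    induction v with
    | zero => simp
    | add a b ha hb => simp only [map_add, TensorProduct.tmul_add, LinearMap.add_apply, ha, hb]
    | tmul c d => simp [coinvRetract_tmul]

/-- A-linearity of the retraction: ∑ a₂ b e(a₁ x) = a b e(x). -/
lemma coinvRetract_diagEnd (he : IsCoinvProj (A := A) e) (a : A) (z : M ⊗[k] A) :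
    coinvRetract e (diagEnd k A M a z) = a • coinvRetract e z := by
  induction z with
  | zero => simp
  | add a b ha hb => simp only [map_add, smul_add, ha, hb]
  | tmul x b =>
    rw [coinvRetract_tmul, diagEnd_apply]
    conv_rhs => rw [← (TensorProduct.lid k A).apply_symm_apply a,
          TensorProduct.lid_symm_apply, ← Coalgebra.rTensor_counit_comul]
    generalize (Coalgebra.comul a : A ⊗[k] A) = v
    induction v with
    | zero => simp
    | add a b ha hb => simp only [map_add, add_smul, LinearMap.add_apply, ha, hb]
    | tmul c d =>
      simp [coinvRetract_tmul, he.map_smul, mul_smul]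
      rw [smul_comm b, smul_comm d]

end Coinvariants

/-! ### The inverse antipode as a skew antipode. -/

section SkewAntipode

/-- Applying S to ∑ S⁻¹(a₂) a₁ and ∑ a₂ S⁻¹(a₁) reverses the products and yields the two antipode
identities. -/
lemma hasSkewAntipode_of_bijective_antipode {k A : Type*} [Field k] [Ring A] [HopfAlgebra k A]
    (h : Function.Bijective (HopfAlgebra.antipode k : A →ₗ[k] A)) : HasSkewAntipode k A := by
  let S := LinearEquiv.ofBijective (HopfAlgebra.antipode k : A →ₗ[k] A) h
  have hS : ∀ a b : A, S (a * b) = S b * S a := HopfAlgebra.antipode_mul_antidistrib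
  have hS' : ∀ r : k, S (algebraMap k A r) = algebraMap k A r := fun r => by
    rw [Algebra.algebraMap_eq_smul_one, map_smul]
    congr 1
    exact HopfAlgebra.antipode_one
  refine ⟨S.symm.toLinearMap, ?_, ?_⟩
  · ext a
    apply S.injective
    simp only [LinearMap.comp_apply, Algebra.linearMap_apply, hS']
    rw [← HopfAlgebra.mul_antipode_rTensor_comul_apply]
    change _ = LinearMap.mul' k A (S.toLinearMap.rTensor A _)
    generalize (Coalgebra.comul a : A ⊗[k] A) = v
    induction v with
    | zero => simp
    | add a b ha hb => simp only [map_add, ha, hb]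
    | tmul c d => simp [hS]
  · ext a
    apply S.injective
    simp only [LinearMap.comp_apply, Algebra.linearMap_apply, hS']
    rw [← HopfAlgebra.mul_antipode_lTensor_comul_apply]
    change _ = LinearMap.mul' k A (S.toLinearMap.lTensor A _)
    generalize (Coalgebra.comul a : A ⊗[k] A) = v
    induction v with
    | zero => simp
    | add a b ha hb => simp only [map_add, ha, hb]
    | tmul c d => simp [hS]

end SkewAntipode

/-! ### Recursive description of Aⁿ ⊗ M and its face maps. -/

section Sources

variable (k A : Type*) [Field k] [Ring A] [Bialgebra k A]

/-- `A ⊗ (Aⁿ ⊗ X) ≃ Aⁿ⁺¹ ⊗ X`. -/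
def consTensor (X : Type*) [AddCommGroup X] [Module k X] (n : ℕ) :
    A ⊗[k] ((⨂[k]^n A) ⊗[k] X) ≃ₗ[k] (⨂[k]^(n + 1) A) ⊗[k] X :=
  (TensorProduct.assoc k A (⨂[k]^n A) X).symm ≪≫ₗ
    TensorProduct.congr (consEquiv k A n) (LinearEquiv.refl k X)

/-- The basis vector of `A⁰`. -/
def emptyTensor : ⨂[k]^0 A := (PiTensorProduct.isEmptyEquiv (Fin 0)).symm 1

/-- `X ≃ A⁰ ⊗ X`. -/
def zeroTensor (X : Type*) [AddCommGroup X] [Module k X] : X ≃ₗ[k] (⨂[k]^0 A) ⊗[k] X :=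
  (TensorProduct.lid k X).symm ≪≫ₗ
    TensorProduct.congr (PiTensorProduct.isEmptyEquiv (Fin 0)).symm (LinearEquiv.refl k X)

variable {k A}
variable {X : Type*} [AddCommGroup X] [Module k X]

lemma consTensor_tmul (n : ℕ) (a : A) (w : ⨂[k]^n A) (x : X) :
    consTensor k A X n (a ⊗ₜ (w ⊗ₜ x)) = consEquiv k A n (a ⊗ₜ w) ⊗ₜ x := rfl

lemma zeroTensor_apply (x : X) : zeroTensor k A X x = emptyTensor k A ⊗ₜ x := rfl

lemma emptyTensor_eq_tprod (v : Fin 0 → A) :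
    emptyTensor k A = PiTensorProduct.tprod k v := by
  rw [emptyTensor, LinearEquiv.symm_apply_eq, PiTensorProduct.isEmptyEquiv_apply_tprod]

/-- The recursions peel off the first factor, while the action on M uses the last; this
compatibility lets both be handled by one induction. -/
lemma snocEquiv_consEquiv (n : ℕ) (a b : A) (w : ⨂[k]^n A) :
    snocEquiv k A (n + 1) (consEquiv k A n (a ⊗ₜ w) ⊗ₜ b) =
      consEquiv k A (n + 1) (a ⊗ₜ snocEquiv k A n (w ⊗ₜ b)) := by
  induction w using PiTensorProduct.induction_on with
  | smul_tprod r v =>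
    simp only [TensorProduct.tmul_smul, map_smul, ← TensorProduct.smul_tmul']
    rw [consEquiv_tmul_tprod, snocEquiv_tprod_tmul, snocEquiv_tprod_tmul, consEquiv_tmul_tprod,
      Fin.cons_snoc_eq_snoc_cons]
  | add x y hx hy => simp only [TensorProduct.tmul_add, TensorProduct.add_tmul, map_add, hx, hy]

lemma snocEquiv_emptyTensor (b : A) :
    snocEquiv k A 0 (emptyTensor k A ⊗ₜ b) = consEquiv k A 0 (b ⊗ₜ emptyTensor k A) := by
  rw [emptyTensor_eq_tprod Fin.elim0, snocEquiv_tprod_tmul, consEquiv_tmul_tprod]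
  congr 1
  funext i
  fin_cases i
  rfl

lemma mulAt_zero_consEquiv (n : ℕ) (a b : A) (w : ⨂[k]^n A) :
    mulAt k A (n + 1) 0 (consEquiv k A (n + 1) (a ⊗ₜ consEquiv k A n (b ⊗ₜ w))) =
      consEquiv k A n ((a * b) ⊗ₜ w) := by
  change consEquiv k A n (_) = _
  simp

lemma mulAt_succ_consEquiv (n : ℕ) (i : Fin n) (a : A) (w : ⨂[k]^(n + 1) A) :
    mulAt k A (n + 1) i.succ (consEquiv k A (n + 1) (a ⊗ₜ w)) =
      consEquiv k A n (a ⊗ₜ mulAt k A n i w) := by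
  change consEquiv k A n (_) = _
  simp

lemma powCoact_consEquiv (n : ℕ) (a : A) (w : ⨂[k]^n A) :
    powCoact k A (n + 1) (consEquiv k A n (a ⊗ₜ w)) =
      TensorProduct.map (consEquiv k A n).toLinearMap (LinearMap.mul' k A)
        (TensorProduct.tensorTensorTensorComm k A A (⨂[k]^n A) A
          (Coalgebra.comul a ⊗ₜ[k] powCoact k A n w)) := by
  simp [powCoact]

lemma mulAt_zero_consTensor (n : ℕ) (a b : A) (z : (⨂[k]^n A) ⊗[k] X) :
    (mulAt k A (n + 1) 0).rTensor X
      (consTensor k A X (n + 1) (a ⊗ₜ consTensor k A X n (b ⊗ₜ z))) =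
      consTensor k A X n ((a * b) ⊗ₜ z) := by
  induction z with
  | zero => simp
  | add x y hx hy => simp only [TensorProduct.tmul_add, map_add, hx, hy]
  | tmul w x => simp only [consTensor_tmul, LinearMap.rTensor_tmul, mulAt_zero_consEquiv]

lemma mulAt_succ_consTensor (n : ℕ) (i : Fin n) (a : A) (z : (⨂[k]^(n + 1) A) ⊗[k] X) :
    (mulAt k A (n + 1) i.succ).rTensor X (consTensor k A X (n + 1) (a ⊗ₜ z)) =
      consTensor k A X n (a ⊗ₜ (mulAt k A n i).rTensor X z) := by
  induction z with
  | zero => simp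
  | add x y hx hy => simp only [TensorProduct.tmul_add, map_add, hx, hy]
  | tmul w x => simp only [consTensor_tmul, LinearMap.rTensor_tmul, mulAt_succ_consEquiv]

variable {M : Type*} [AddCommGroup M] [Module k M] [Module A M] [IsScalarTower k A M]

lemma actLast_snocEquiv (n : ℕ) (w : ⨂[k]^n A) (a : A) (m : M) :
    actLast k A M n (snocEquiv k A n (w ⊗ₜ a) ⊗ₜ m) = w ⊗ₜ (a • m) := by
  simp [actLast]

lemma actLast_consTensor (n : ℕ) (a : A) (z : (⨂[k]^(n + 1) A) ⊗[k] M) :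
    actLast k A M (n + 1) (consTensor k A M (n + 1) (a ⊗ₜ z)) =
      consTensor k A M n (a ⊗ₜ actLast k A M n z) := by
  induction z with
  | zero => simp
  | add x y hx hy => simp only [TensorProduct.tmul_add, map_add, hx, hy]
  | tmul v m =>
    obtain ⟨v, rfl⟩ := (snocEquiv k A n).surjective v
    induction v with
    | zero => simp
    | add x y hx hy => simp only [TensorProduct.tmul_add, TensorProduct.add_tmul, map_add, hx, hy]
    | tmul w b =>
      rw [actLast_snocEquiv, consTensor_tmul, consTensor_tmul, ← snocEquiv_consEquiv,
        actLast_snocEquiv]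

lemma actLast_zeroTensor (a : A) (m : M) :
    actLast k A M 0 (consTensor k A M 0 (a ⊗ₜ zeroTensor k A M m)) =
      zeroTensor k A M (a • m) := by
  rw [zeroTensor_apply, consTensor_tmul, ← snocEquiv_emptyTensor, actLast_snocEquiv,
    zeroTensor_apply]

end Sources

/-! ### Colinearity of the source face maps. -/

section SourceCoactions

variable {k A : Type*} [Field k] [Ring A] [Bialgebra k A]
variable {M : Type*} [AddCommGroup M] [Module k M] [RightComodule k A M]

lemma codiagCoact_tmul (n : ℕ) (w : ⨂[k]^n A) (m : M) :
    codiagCoact k A M n (w ⊗ₜ m) = (LinearMap.mul' k A).lTensor _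
      (TensorProduct.tensorTensorTensorComm k (⨂[k]^n A) A M A
        (powCoact k A n w ⊗ₜ RightComodule.coact m)) := rfl

lemma isColinear_zeroTensor : IsColinear (RightComodule.coact : M →ₗ[k] M ⊗[k] A)
    (codiagCoact k A M 0) (zeroTensor k A M).toLinearMap := by
  intro m
  rw [LinearEquiv.coe_coe, zeroTensor_apply, codiagCoact_tmul]
  have : powCoact k A 0 (emptyTensor k A) = emptyTensor k A ⊗ₜ 1 := rfl
  rw [this]
  generalize (RightComodule.coact m : M ⊗[k] A) = w
  induction w with
  | zero => simp
  | add a b ha hb => simp only [map_add, TensorProduct.tmul_add, ha, hb]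
  | tmul x b => simp [zeroTensor_apply]

-- Up to associativity in A, the codiagonal coaction is obtained by iterating `tensorCoact`. Its
-- coaction axioms and the colinearity of the faces thereby follow by induction on n.
set_option synthInstance.maxHeartbeats 100000 in
lemma isColinear_consTensor (n : ℕ) : IsColinear (tensorCoact (codiagCoact k A M n))
    (codiagCoact k A M (n + 1)) (consTensor k A M n).toLinearMap := by
  intro z
  induction z with
  | zero => simp
  | add a b ha hb => simp only [map_add, ha, hb]
  | tmul a z =>
    induction z with
    | zero => simp
    | add a b ha hb => simp only [TensorProduct.tmul_add, map_add, ha, hb]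
    | tmul w m =>
      rw [LinearEquiv.coe_coe, consTensor_tmul, codiagCoact_tmul, powCoact_consEquiv,
        tensorCoact_tmul, codiagCoact_tmul]
      generalize (RightComodule.coact m : M ⊗[k] A) = u
      generalize powCoact k A n w = w
      generalize (Coalgebra.comul a : A ⊗[k] A) = v
      induction u with
      | zero => simp
      | add a b ha hb => simp only [map_add, TensorProduct.tmul_add, ha, hb]
      | tmul x b =>
        induction w with
        | zero => simp
        | add a b ha hb =>
          simp only [map_add, TensorProduct.tmul_add, TensorProduct.add_tmul, ha, hb]
        | tmul w c =>
          induction v with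
          | zero => simp
          | add a b ha hb => simp only [map_add, TensorProduct.add_tmul, ha, hb]
          | tmul d e => simp [consTensor_tmul, mul_assoc]

lemma isCoaction_codiagCoact (n : ℕ) : IsCoaction (codiagCoact k A M n) := by
  induction n with
  | zero => exact RightComodule.isCoaction.of_equiv _ isColinear_zeroTensor
  | succ n ih => exact ih.tensorCoact.of_equiv _ (isColinear_consTensor n)

section Colinear

variable {X Y Z : Type*} [AddCommGroup X] [Module k X] [AddCommGroup Y] [Module k Y]
  [AddCommGroup Z] [Module k Z] {r : X →ₗ[k] X ⊗[k] A} {s : Y →ₗ[k] Y ⊗[k] A}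
  {t : Z →ₗ[k] Z ⊗[k] A}

lemma IsColinear.comp {g : Y →ₗ[k] Z} {f : X →ₗ[k] Y} (hg : IsColinear s t g)
    (hf : IsColinear r s f) : IsColinear r t (g ∘ₗ f) := by
  intro x
  rw [LinearMap.comp_apply, hg, hf, LinearMap.rTensor_comp_apply]

lemma IsColinear.symm {f : X ≃ₗ[k] Y} (hf : IsColinear r s f.toLinearMap) :
    IsColinear s r f.symm.toLinearMap := by
  intro y
  obtain ⟨x, rfl⟩ := f.surjective y
  have := hf x
  rw [LinearEquiv.coe_coe] at this
  rw [this, ← LinearMap.rTensor_comp_apply]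
  simp

/-- Colinearity can be checked after precomposing with a colinear isomorphism. -/
lemma IsColinear.of_comp_equiv {g : Y →ₗ[k] Z} {f : X ≃ₗ[k] Y}
    (hf : IsColinear r s f.toLinearMap) (h : IsColinear r t (g ∘ₗ f.toLinearMap)) :
    IsColinear s t g := by
  have := h.comp hf.symm
  rwa [LinearMap.comp_assoc, LinearEquiv.comp_symm, LinearMap.comp_id] at this

lemma isColinear_mul_tensor (r : X →ₗ[k] X ⊗[k] A) :
    IsColinear (tensorCoact (tensorCoact r)) (tensorCoact r)
      ((LinearMap.mul' k A).rTensor X ∘ₗ (TensorProduct.assoc k A A X).symm.toLinearMap) := by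
  intro z
  induction z with
  | zero => simp
  | add a b ha hb => simp only [map_add, ha, hb]
  | tmul a z =>
    induction z with
    | zero => simp
    | add a b ha hb => simp only [TensorProduct.tmul_add, map_add, ha, hb]
    | tmul b x =>
      simp only [LinearMap.comp_apply, LinearEquiv.coe_coe, TensorProduct.assoc_symm_tmul,
        LinearMap.rTensor_tmul, LinearMap.mul'_apply, tensorCoact_tmul, Bialgebra.comul_mul]
      generalize r x = u
      generalize (Coalgebra.comul b : A ⊗[k] A) = w
      generalize (Coalgebra.comul a : A ⊗[k] A) = v
      induction u with
      | zero => simp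
      | add a b ha hb => simp only [map_add, TensorProduct.tmul_add, ha, hb]
      | tmul x b =>
        induction w with
        | zero => simp
        | add a b ha hb =>
          simp only [map_add, mul_add, TensorProduct.tmul_add, TensorProduct.add_tmul, ha, hb]
        | tmul w c =>
          induction v with
          | zero => simp
          | add a b ha hb => simp only [map_add, add_mul, TensorProduct.add_tmul, ha, hb]
          | tmul d e => simp [mul_assoc]

end Colinear

/-- Multiplying the first two factors is colinear because Δ is multiplicative; later products reduce
to this one by tensoring with A on the left. -/
lemma isColinear_mulAt (n : ℕ) (i : Fin n) : IsColinear (codiagCoact k A M (n + 1))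
    (codiagCoact k A M n) ((mulAt k A n i).rTensor M) := by
  induction n with
  | zero => exact i.elim0
  | succ n ih =>
    refine IsColinear.of_comp_equiv (isColinear_consTensor (n + 1)) ?_
    refine Fin.cases ?_ (fun i => ?_) i
    · refine IsColinear.of_comp_equiv
        (f := LinearEquiv.lTensor A (consTensor k A M n)) (isColinear_consTensor n).lTensor ?_
      convert (isColinear_consTensor n).comp (isColinear_mul_tensor (codiagCoact k A M n)) using 1
      refine TensorProduct.ext' fun a z => ?_
      induction z with
      | zero => simp
      | add a b ha hb => simp only [TensorProduct.tmul_add, map_add, ha, hb]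
      | tmul b z => exact mulAt_zero_consTensor n a b z
    · convert (isColinear_consTensor n).comp (ih i).lTensor using 1
      exact TensorProduct.ext' fun a z => mulAt_succ_consTensor n i a z

lemma isColinear_actLast [Module A M] [IsScalarTower k A M] [IsHopfModule k A M] (n : ℕ) :
    IsColinear (codiagCoact k A M (n + 1)) (codiagCoact k A M n) (actLast k A M n) := by
  induction n with
  | zero =>
    refine IsColinear.of_comp_equiv (isColinear_consTensor 0) ?_
    refine IsColinear.of_comp_equiv
        (f := LinearEquiv.lTensor A (zeroTensor k A M)) isColinear_zeroTensor.lTensor ?_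
    -- The Hopf module axiom, read as colinearity of the action map.
    have h : IsColinear (tensorCoact (RightComodule.coact : M →ₗ[k] M ⊗[k] A)) RightComodule.coact
        (TensorProduct.lift (Algebra.lsmul k k M).toLinearMap) := by
      intro z
      induction z with
      | zero => simp
      | add a b ha hb => simp only [map_add, ha, hb]
      | tmul a m =>
        change RightComodule.coact (a • m) = _
        rw [IsHopfModule.coact_smul, tensorCoact_tmul]
        generalize (RightComodule.coact m : M ⊗[k] A) = u
        generalize (Coalgebra.comul a : A ⊗[k] A) = v
        induction u with
        | zero => simp
        | add a b ha hb => simp only [map_add, TensorProduct.tmul_add, ha, hb]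
        | tmul x b =>
          induction v with
          | zero => simp
          | add a b ha hb =>
            simp only [map_add, LinearMap.add_apply, TensorProduct.add_tmul, ha, hb]
          | tmul d e => simp
    convert isColinear_zeroTensor.comp h using 1
    exact TensorProduct.ext' fun a m => actLast_zeroTensor a m
  | succ n ih =>
    refine IsColinear.of_comp_equiv (isColinear_consTensor (n + 1)) ?_
    convert (isColinear_consTensor n).comp ih.lTensor using 1
    exact TensorProduct.ext' fun a z => actLast_consTensor n a z

end SourceCoactions

/-! ### The section on Aⁿ ⊗ M and its interaction with the faces. -/

section SourceSplitting

variable {k A : Type*} [Field k] [Ring A] [Bialgebra k A]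
variable {M : Type*} [AddCommGroup M] [Module k M] [RightComodule k A M]

/-- `Aⁿ ⊗ M → Aⁿ⁺¹ ⊗ M`, `a¹ ⊗ ⋯ ⊗ aⁿ ⊗ m ↦ ∑ a¹ ⊗ ⋯ ⊗ aⁿ ⊗ m₁ ⊗ e(m₀)`. -/
def splitLast (e : M →ₗ[k] M) : (n : ℕ) → ((⨂[k]^n A) ⊗[k] M →ₗ[k] (⨂[k]^(n + 1) A) ⊗[k] M)
  | 0 => (consTensor k A M 0).toLinearMap ∘ₗ (zeroTensor k A M).toLinearMap.lTensor A ∘ₗ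
      coinvSplit e ∘ₗ (zeroTensor k A M).symm.toLinearMap
  | n + 1 => (consTensor k A M (n + 1)).toLinearMap ∘ₗ (splitLast e n).lTensor A ∘ₗ
      (consTensor k A M n).symm.toLinearMap

lemma splitLast_zeroTensor (e : M →ₗ[k] M) (m : M) :
    splitLast (A := A) e 0 (zeroTensor k A M m) =
      consTensor k A M 0 ((zeroTensor k A M).toLinearMap.lTensor A (coinvSplit e m)) := by
  simp [splitLast]

lemma splitLast_consTensor (e : M →ₗ[k] M) (n : ℕ) (a : A) (z : (⨂[k]^n A) ⊗[k] M) :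
    splitLast e (n + 1) (consTensor k A M n (a ⊗ₜ z)) =
      consTensor k A M (n + 1) (a ⊗ₜ splitLast e n z) := by
  simp [splitLast]

/-- These products involve only the original n + 1 algebra factors, and the splitting alters only M.
-/
lemma mulAt_castSucc_splitLast (e : M →ₗ[k] M) (n : ℕ) (i : Fin n) (z : (⨂[k]^(n + 1) A) ⊗[k] M) :
    (mulAt k A (n + 1) i.castSucc).rTensor M (splitLast e (n + 1) z) =
      splitLast e n ((mulAt k A n i).rTensor M z) := by
  induction n with
  | zero => exact i.elim0
  | succ n ih =>
    obtain ⟨z, rfl⟩ := (consTensor k A M (n + 1)).surjective z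
    induction z with
    | zero => simp
    | add a b ha hb => simp only [map_add, ha, hb]
    | tmul a z =>
      rw [splitLast_consTensor]
      refine Fin.cases ?_ (fun i => ?_) i
      · obtain ⟨z, rfl⟩ := (consTensor k A M n).surjective z
        induction z with
        | zero => simp
        | add a b ha hb => simp only [TensorProduct.tmul_add, map_add, ha, hb]
        | tmul b z =>
          rw [mulAt_zero_consTensor, splitLast_consTensor, splitLast_consTensor, Fin.castSucc_zero,
            mulAt_zero_consTensor]
      · rw [← Fin.succ_castSucc, mulAt_succ_consTensor, mulAt_succ_consTensor, ih,
          splitLast_consTensor]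

variable [Module A M] [IsScalarTower k A M] {e : M →ₗ[k] M}

lemma isColinear_splitLast (he : IsCoinvProj (A := A) e) (n : ℕ) :
    IsColinear (codiagCoact k A M n) (codiagCoact k A M (n + 1)) (splitLast e n) := by
  induction n with
  | zero => exact (isColinear_consTensor 0).comp (isColinear_zeroTensor.lTensor.comp
      ((isColinear_coinvSplit he).comp isColinear_zeroTensor.symm))
  | succ n ih => exact (isColinear_consTensor (n + 1)).comp (ih.lTensor.comp
      (isColinear_consTensor n).symm)

lemma actLast_splitLast (he : IsCoinvProj (A := A) e) (n : ℕ) (z : (⨂[k]^n A) ⊗[k] M) :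
    actLast k A M n (splitLast e n z) = z := by
  induction n with
  | zero =>
    obtain ⟨m, rfl⟩ := (zeroTensor k A M).surjective z
    rw [splitLast_zeroTensor]
    conv_rhs => rw [← he.smul_split m]
    generalize coinvSplit (A := A) e m = w
    induction w with
    | zero => simp
    | add a b ha hb => simp only [map_add, ha, hb]
    | tmul a m => simpa using actLast_zeroTensor a m
  | succ n ih =>
    obtain ⟨z, rfl⟩ := (consTensor k A M n).surjective z
    induction z with
    | zero => simp
    | add a b ha hb => simp only [map_add, ha, hb]
    | tmul a z => rw [splitLast_consTensor, actLast_consTensor, ih]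

/-- The last product meets the new factor m₁; A-linearity of the splitting turns it into the action
on m. -/
lemma mulAt_last_splitLast [IsHopfModule k A M] (he : IsCoinvProj (A := A) e) (n : ℕ)
    (z : (⨂[k]^(n + 1) A) ⊗[k] M) :
    (mulAt k A (n + 1) (Fin.last n)).rTensor M (splitLast e (n + 1) z) =
      splitLast e n (actLast k A M n z) := by
  induction n with
  | zero =>
    obtain ⟨z, rfl⟩ := (consTensor k A M 0).surjective z
    induction z with
    | zero => simp
    | add a b ha hb => simp only [map_add, ha, hb]
    | tmul a z =>
      obtain ⟨m, rfl⟩ := (zeroTensor k A M).surjective z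
      rw [splitLast_consTensor, actLast_zeroTensor, splitLast_zeroTensor, splitLast_zeroTensor,
        coinvSplit_smul he]
      generalize coinvSplit (A := A) e m = w
      induction w with
      | zero => simp
      | add a b ha hb => simp only [TensorProduct.tmul_add, map_add, ha, hb]
      | tmul b m => exact mulAt_zero_consTensor 0 a b (zeroTensor k A M m)
  | succ n ih =>
    obtain ⟨z, rfl⟩ := (consTensor k A M (n + 1)).surjective z
    induction z with
    | zero => simp
    | add a b ha hb => simp only [map_add, ha, hb]
    | tmul a z =>
      rw [splitLast_consTensor, ← Fin.succ_last, mulAt_succ_consTensor, ih, actLast_consTensor,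
        splitLast_consTensor]

end SourceSplitting

/-! ### The retraction on N ⊗ Aᵖ and its interaction with the cofaces and the diagonal action. -/

section Targets

variable (k A : Type*) [Field k] [Ring A] [Bialgebra k A]
variable (N : Type*) [AddCommGroup N] [Module k N]

/-- `(N ⊗ A) ⊗ Aᵖ ≃ N ⊗ Aᵖ⁺¹`. -/
def tensorCons (p : ℕ) : (N ⊗[k] A) ⊗[k] (⨂[k]^p A) ≃ₗ[k] N ⊗[k] (⨂[k]^(p + 1) A) :=
  TensorProduct.assoc k N A (⨂[k]^p A) ≪≫ₗ
    TensorProduct.congr (LinearEquiv.refl k N) (consEquiv k A p)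

/-- `N ≃ N ⊗ A⁰`. -/
def tensorZero : N ≃ₗ[k] N ⊗[k] (⨂[k]^0 A) :=
  (TensorProduct.rid k N).symm ≪≫ₗ
    TensorProduct.congr (LinearEquiv.refl k N) (PiTensorProduct.isEmptyEquiv (Fin 0)).symm

/-- `(N ⊗ Aᵖ) ⊗ A → N ⊗ Aᵖ⁺¹`. -/
def tensorSnoc (p : ℕ) : (N ⊗[k] (⨂[k]^p A)) ⊗[k] A →ₗ[k] N ⊗[k] (⨂[k]^(p + 1) A) :=
  (snocEquiv k A p).toLinearMap.lTensor N ∘ₗ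
    (TensorProduct.assoc k N (⨂[k]^p A) A).toLinearMap

variable {k A N}

lemma tensorCons_tmul (p : ℕ) (x : N) (a : A) (w : ⨂[k]^p A) :
    tensorCons k A N p ((x ⊗ₜ a) ⊗ₜ w) = x ⊗ₜ consEquiv k A p (a ⊗ₜ w) := rfl

lemma tensorZero_apply (x : N) : tensorZero k A N x = x ⊗ₜ emptyTensor k A := rfl

lemma tensorSnoc_tmul (p : ℕ) (x : N) (w : ⨂[k]^p A) (a : A) :
    tensorSnoc k A N p ((x ⊗ₜ w) ⊗ₜ a) = x ⊗ₜ snocEquiv k A p (w ⊗ₜ a) := rfl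

lemma tensorSnoc_tensorZero (x : N) (a : A) :
    tensorSnoc k A N 0 (tensorZero k A N x ⊗ₜ a) =
      tensorCons k A N 0 ((x ⊗ₜ a) ⊗ₜ emptyTensor k A) := by
  rw [tensorZero_apply, tensorSnoc_tmul, snocEquiv_emptyTensor, tensorCons_tmul]

lemma comulAt_zero_consEquiv (p : ℕ) (a : A) (w : ⨂[k]^p A) :
    comulAt k A (p + 1) 0 (consEquiv k A p (a ⊗ₜ w)) =
      consEquiv k A (p + 1) ((consEquiv k A p).toLinearMap.lTensor A
        (TensorProduct.assoc k A A (⨂[k]^p A) (Coalgebra.comul a ⊗ₜ w))) := by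
  change consEquiv k A (p + 1) (_) = _
  simp

lemma comulAt_succ_consEquiv (p : ℕ) (i : Fin p) (a : A) (w : ⨂[k]^p A) :
    comulAt k A (p + 1) i.succ (consEquiv k A p (a ⊗ₜ w)) =
      consEquiv k A (p + 1) (a ⊗ₜ comulAt k A p i w) := by
  change consEquiv k A (p + 1) (_) = _
  simp

lemma iterComul_succ_apply (p : ℕ) (a : A) :
    iterComul k A (p + 1) a = consEquiv k A p ((iterComul k A p).lTensor A (Coalgebra.comul a)) :=
  rfl

lemma iterComul_zero_apply (a : A) :
    iterComul k A 0 a = (Coalgebra.counit a : k) • emptyTensor k A := by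
  simp [iterComul, emptyTensor]

lemma consEquiv_mul (p : ℕ) (a b : A) (v w : ⨂[k]^p A) :
    consEquiv k A p (a ⊗ₜ v) * consEquiv k A p (b ⊗ₜ w) =
      consEquiv k A p ((a * b) ⊗ₜ (v * w)) := by
  induction v using PiTensorProduct.induction_on with
  | add x y hx hy => simp only [TensorProduct.tmul_add, add_mul, map_add, hx, hy]
  | smul_tprod r v =>
    induction w using PiTensorProduct.induction_on with
    | add x y hx hy => simp only [TensorProduct.tmul_add, mul_add, map_add, hx, hy]
    | smul_tprod s w =>
      simp only [TensorProduct.tmul_smul, map_smul, smul_mul_assoc, mul_smul_comm]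
      rw [consEquiv_tmul_tprod, consEquiv_tmul_tprod, PiTensorProduct.tprod_mul_tprod,
        PiTensorProduct.tprod_mul_tprod, consEquiv_tmul_tprod]
      congr 3
      funext i
      refine Fin.cases ?_ (fun i => ?_) i <;> simp

lemma emptyTensor_mul_self : emptyTensor k A * emptyTensor k A = emptyTensor k A := by
  rw [emptyTensor_eq_tprod Fin.elim0, PiTensorProduct.tprod_mul_tprod, ← emptyTensor_eq_tprod,
    ← emptyTensor_eq_tprod]

section Action

variable [Module A N] [IsScalarTower k A N]

lemma diagAct_tmul (p : ℕ) (a : A) (z : N ⊗[k] (⨂[k]^p A)) :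
    diagAct k A N p (a ⊗ₜ z) = TensorProduct.map₂ (Algebra.lsmul k k N).toLinearMap
      (LinearMap.mul k (⨂[k]^p A)) ((iterComul k A p).lTensor A (Coalgebra.comul a)) z := rfl

lemma diagAct_tensorZero (a : A) (x : N) :
    diagAct k A N 0 (a ⊗ₜ tensorZero k A N x) = tensorZero k A N (a • x) := by
  rw [diagAct_tmul, tensorZero_apply, tensorZero_apply]
  conv_rhs => rw [← (TensorProduct.rid k A).apply_symm_apply a,
        TensorProduct.rid_symm_apply, ← Coalgebra.lTensor_counit_comul]
  generalize (Coalgebra.comul a : A ⊗[k] A) = v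
  induction v with
  | zero => simp
  | add a b ha hb =>
    simp only [map_add, LinearMap.add_apply, add_smul, TensorProduct.add_tmul, ha, hb]
  | tmul c d =>
    simp [iterComul_zero_apply, emptyTensor_mul_self, TensorProduct.smul_tmul']

/-- Coassociativity regroups the iterated coproduct so that one copy of a acts diagonally on N ⊗ A,
where the retraction is known to be A-linear. -/
lemma diagAct_tensorCons (p : ℕ) (a : A) (y : N ⊗[k] A) (w : ⨂[k]^p A) :
    diagAct k A N (p + 1) (a ⊗ₜ tensorCons k A N p (y ⊗ₜ w)) =
      tensorCons k A N p (TensorProduct.map₂ (diagEnd k A N).toLinearMap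
        (LinearMap.mul k (⨂[k]^p A)) ((iterComul k A p).lTensor A (Coalgebra.comul a))
          (y ⊗ₜ w)) := by
  let Θ : A ⊗[k] (A ⊗[k] A) →ₗ[k] N ⊗[k] (⨂[k]^(p + 1) A) :=
    (tensorCons k A N p).toLinearMap ∘ₗ (TensorProduct.map₂
      (TensorProduct.map₂ (Algebra.lsmul k k N).toLinearMap (LinearMap.mul k A))
      (LinearMap.mul k (⨂[k]^p A))).flip (y ⊗ₜ w) ∘ₗ (iterComul k A p).lTensor (A ⊗[k] A) ∘ₗ
      (TensorProduct.assoc k A A A).symm.toLinearMap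
  trans Θ (Coalgebra.comul.lTensor A (Coalgebra.comul a))
  · rw [diagAct_tmul]
    generalize (Coalgebra.comul a : A ⊗[k] A) = v
    induction v with
    | zero => simp
    | add a b ha hb => simp only [map_add, LinearMap.add_apply, ha, hb]
    | tmul c d =>
      rw [LinearMap.lTensor_tmul, LinearMap.lTensor_tmul, iterComul_succ_apply]
      generalize (Coalgebra.comul d : A ⊗[k] A) = v
      induction v with
      | zero => simp
      | add a b ha hb => simp only [map_add, TensorProduct.tmul_add, LinearMap.add_apply, ha, hb]
      | tmul d f =>
        simp only [Θ, LinearMap.comp_apply, LinearMap.flip_apply, LinearEquiv.coe_coe,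
          TensorProduct.assoc_symm_tmul, LinearMap.lTensor_tmul]
        induction y with
        | zero => simp
        | add a b ha hb => simp only [map_add, TensorProduct.add_tmul, ha, hb]
        | tmul x b => simp [tensorCons_tmul, consEquiv_mul]
  · rw [← Coalgebra.coassoc_apply]
    generalize (Coalgebra.comul a : A ⊗[k] A) = v
    induction v with
    | zero => simp
    | add a b ha hb => simp only [map_add, LinearMap.add_apply, ha, hb]
    | tmul c d => simp [Θ, diagEnd_apply]

/-- `N ⊗ Aᵖ⁺¹ → N ⊗ Aᵖ`, `x ⊗ c ⊗ c¹ ⊗ ⋯ ⊗ cᵖ ↦ c e(x) ⊗ c¹ ⊗ ⋯ ⊗ cᵖ`. -/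
def retractFirst (e : N →ₗ[k] N) (p : ℕ) : N ⊗[k] (⨂[k]^(p + 1) A) →ₗ[k] N ⊗[k] (⨂[k]^p A) :=
  (coinvRetract e).rTensor _ ∘ₗ (tensorCons k A N p).symm.toLinearMap

lemma retractFirst_tensorCons (e : N →ₗ[k] N) (p : ℕ) (y : N ⊗[k] A) (w : ⨂[k]^p A) :
    retractFirst e p (tensorCons k A N p (y ⊗ₜ w)) = coinvRetract e y ⊗ₜ w := by
  simp [retractFirst]

lemma retractFirst_comulAt_succ (e : N →ₗ[k] N) (p : ℕ) (i : Fin p)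
    (z : N ⊗[k] (⨂[k]^(p + 1) A)) :
    retractFirst e (p + 1) ((comulAt k A (p + 1) i.succ).lTensor N z) =
      (comulAt k A p i).lTensor N (retractFirst e p z) := by
  obtain ⟨z, rfl⟩ := (tensorCons k A N p).surjective z
  induction z with
  | zero => simp
  | add a b ha hb => simp only [map_add, ha, hb]
  | tmul y w =>
    induction y with
    | zero => simp
    | add a b ha hb => simp only [TensorProduct.add_tmul, map_add, ha, hb]
    | tmul x a =>
      rw [retractFirst_tensorCons, tensorCons_tmul, LinearMap.lTensor_tmul, LinearMap.lTensor_tmul,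
        comulAt_succ_consEquiv, ← tensorCons_tmul, retractFirst_tensorCons]

lemma retractFirst_tensorSnoc (e : N →ₗ[k] N) (p : ℕ)
    (z : (N ⊗[k] (⨂[k]^(p + 1) A)) ⊗[k] A) :
    retractFirst e (p + 1) (tensorSnoc k A N (p + 1) z) =
      tensorSnoc k A N p ((retractFirst e p).rTensor A z) := by
  induction z with
  | zero => simp
  | add a b ha hb => simp only [map_add, ha, hb]
  | tmul z b =>
    obtain ⟨z, rfl⟩ := (tensorCons k A N p).surjective z
    induction z with
    | zero => simp
    | add a b ha hb => simp only [TensorProduct.add_tmul, map_add, ha, hb]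
    | tmul y w =>
      induction y with
      | zero => simp
      | add a b ha hb => simp only [TensorProduct.add_tmul, map_add, ha, hb]
      | tmul x a =>
        rw [LinearMap.rTensor_tmul, retractFirst_tensorCons, tensorCons_tmul, tensorSnoc_tmul,
          tensorSnoc_tmul, snocEquiv_consEquiv, ← tensorCons_tmul, retractFirst_tensorCons]

/-- `(N ⊗ A⁰) ⊗ A → N ⊗ A⁰`, `x ⊗ a ↦ a e(x)`. -/
def retractZero (e : N →ₗ[k] N) : (N ⊗[k] (⨂[k]^0 A)) ⊗[k] A →ₗ[k] N ⊗[k] (⨂[k]^0 A) :=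
  retractFirst e 0 ∘ₗ tensorSnoc k A N 0

lemma retractZero_tmul (e : N →ₗ[k] N) (x : N) (a : A) :
    retractZero e (tensorZero k A N x ⊗ₜ a) = tensorZero k A N (coinvRetract e (x ⊗ₜ a)) := by
  rw [retractZero, LinearMap.comp_apply, tensorSnoc_tensorZero, retractFirst_tensorCons,
    tensorZero_apply]

end Action

section Coaction

variable [RightComodule k A N]

lemma coactFirst_tmul (p : ℕ) (x : N) (w : ⨂[k]^p A) :
    coactFirst k A N p (x ⊗ₜ w) = tensorCons k A N p (RightComodule.coact x ⊗ₜ w) := rfl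

lemma coactFirst_tensorZero (x : N) : coactFirst k A N 0 (tensorZero k A N x) =
    tensorSnoc k A N 0 ((tensorZero k A N).toLinearMap.rTensor A (RightComodule.coact x)) := by
  rw [tensorZero_apply, coactFirst_tmul]
  generalize (RightComodule.coact x : N ⊗[k] A) = w
  induction w with
  | zero => simp
  | add a b ha hb => simp only [map_add, TensorProduct.add_tmul, ha, hb]
  | tmul x a =>
    rw [LinearMap.rTensor_tmul, LinearEquiv.coe_coe, tensorSnoc_tensorZero]

variable [Module A N] [IsScalarTower k A N] {e : N →ₗ[k] N}

lemma retractFirst_coactFirst (he : IsCoinvProj (A := A) e) (p : ℕ) (z : N ⊗[k] (⨂[k]^p A)) :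
    retractFirst e p (coactFirst k A N p z) = z := by
  induction z with
  | zero => simp
  | add a b ha hb => simp only [map_add, ha, hb]
  | tmul x w => rw [coactFirst_tmul, retractFirst_tensorCons, coinvRetract_coact he]

lemma retractFirst_diagAct (he : IsCoinvProj (A := A) e) (p : ℕ) (a : A)
    (z : N ⊗[k] (⨂[k]^(p + 1) A)) :
    retractFirst e p (diagAct k A N (p + 1) (a ⊗ₜ z)) =
      diagAct k A N p (a ⊗ₜ retractFirst e p z) := by
  obtain ⟨z, rfl⟩ := (tensorCons k A N p).surjective z
  induction z with
  | zero => simp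
  | add a b ha hb => simp only [map_add, TensorProduct.tmul_add, ha, hb]
  | tmul y w =>
    rw [diagAct_tensorCons, retractFirst_tensorCons, diagAct_tmul]
    generalize (Coalgebra.comul a : A ⊗[k] A) = v
    induction v with
    | zero => simp
    | add a b ha hb => simp only [map_add, LinearMap.add_apply, ha, hb]
    | tmul c d => simp [retractFirst_tensorCons, coinvRetract_diagEnd he]

lemma retractZero_diagAct (he : IsCoinvProj (A := A) e) (a b : A) (z : N ⊗[k] (⨂[k]^0 A)) :
    retractZero e ((diagAct k A N 0).rTensor A ((LinearMap.mul' k A).lTensor _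
      (TensorProduct.tensorTensorTensorComm k A A _ A (Coalgebra.comul a ⊗ₜ[k] (z ⊗ₜ b))))) =
      diagAct k A N 0 (a ⊗ₜ retractZero e (z ⊗ₜ b)) := by
  obtain ⟨x, rfl⟩ := (tensorZero k A N).surjective z
  rw [retractZero_tmul, diagAct_tensorZero, ← coinvRetract_diagEnd he, diagEnd_apply]
  generalize (Coalgebra.comul a : A ⊗[k] A) = v
  induction v with
  | zero => simp
  | add a b ha hb => simp only [map_add, TensorProduct.add_tmul, LinearMap.add_apply, ha, hb]
  | tmul c d => simp [diagAct_tensorZero, retractZero_tmul]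

variable [IsHopfModule k A N]

/-- Colinearity of the retraction turns Δ on the first algebra factor into ρ_N. -/
lemma retractFirst_comulAt_zero (he : IsCoinvProj (A := A) e) (p : ℕ)
    (z : N ⊗[k] (⨂[k]^(p + 1) A)) :
    retractFirst e (p + 1) ((comulAt k A (p + 1) 0).lTensor N z) =
      coactFirst k A N p (retractFirst e p z) := by
  obtain ⟨z, rfl⟩ := (tensorCons k A N p).surjective z
  induction z with
  | zero => simp
  | add a b ha hb => simp only [map_add, ha, hb]
  | tmul y w =>
    rw [retractFirst_tensorCons, coactFirst_tmul, coact_coinvRetract he]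
    induction y with
    | zero => simp
    | add a b ha hb => simp only [TensorProduct.add_tmul, map_add, ha, hb]
    | tmul x a =>
      rw [tensorCons_tmul, LinearMap.lTensor_tmul, comulAt_zero_consEquiv, LinearMap.lTensor_tmul]
      generalize (Coalgebra.comul a : A ⊗[k] A) = v
      induction v with
      | zero => simp
      | add a b ha hb =>
        simp only [map_add, TensorProduct.tmul_add, TensorProduct.add_tmul, ha, hb]
      | tmul c d =>
        simp only [TensorProduct.assoc_tmul, LinearMap.lTensor_tmul, LinearEquiv.coe_coe,
          TensorProduct.assoc_symm_tmul, LinearMap.rTensor_tmul]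
        rw [← tensorCons_tmul, retractFirst_tensorCons, tensorCons_tmul]

lemma coactFirst_retractZero (he : IsCoinvProj (A := A) e) (z : (N ⊗[k] (⨂[k]^0 A)) ⊗[k] A) :
    coactFirst k A N 0 (retractZero e z) =
      tensorSnoc k A N 0 ((retractZero e).rTensor A ((TensorProduct.assoc k _ A A).symm
        ((Coalgebra.comul : A →ₗ[k] A ⊗[k] A).lTensor _ z))) := by
  induction z with
  | zero => simp
  | add a b ha hb => simp only [map_add, ha, hb]
  | tmul z a =>
    obtain ⟨x, rfl⟩ := (tensorZero k A N).surjective z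
    rw [retractZero_tmul, coactFirst_tensorZero, coact_coinvRetract he, LinearMap.lTensor_tmul,
      LinearMap.lTensor_tmul]
    generalize (Coalgebra.comul a : A ⊗[k] A) = v
    induction v with
    | zero => simp
    | add a b ha hb => simp only [map_add, TensorProduct.tmul_add, ha, hb]
    | tmul c d => simp [retractZero_tmul]

end Coaction

end Targets

/-! ### The homotopies s and t, and the projection π to colinear maps. -/

section Homotopies

variable {k A M N : Type*} [Field k] [Ring A] [Bialgebra k A]
  [AddCommGroup M] [Module k M]
  [AddCommGroup N] [Module k N] [Module A N] [IsScalarTower k A N]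

lemma bFirst_consTensor (n p : ℕ) (f : Cochain k A M N n p)
    (z : A ⊗[k] ((⨂[k]^n A) ⊗[k] M)) :
    bFirst k A M N n p f (consTensor k A M n z) = diagAct k A N p (f.lTensor A z) := by
  change diagAct k A N p (f.lTensor A ((consTensor k A M n).symm (consTensor k A M n z))) = _
  rw [LinearEquiv.symm_apply_apply]

variable [RightComodule k A M]

/-- Precomposition with `splitLast`, a contracting homotopy for `d_m`. -/
def splitHom {N : Type*} [AddCommGroup N] [Module k N] (e : M →ₗ[k] M) (n p : ℕ) : Cochain k A M N (n + 1) p →ₗ[k] Cochain k A M N n p :=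
  LinearMap.lcomp k _ (splitLast e n)

/-- Postcomposition with `retractFirst`, a contracting homotopy for `d_c`. -/
def retractHom (e : N →ₗ[k] N) (n p : ℕ) : Cochain k A M N n (p + 1) →ₗ[k] Cochain k A M N n p :=
  LinearMap.llcomp k _ _ _ (retractFirst e p)

/-- The projection of `Cⁿ⁰(M, N)` to the colinear maps. -/
def colinearProj (e : N →ₗ[k] N) (n : ℕ) : Cochain k A M N n 0 →ₗ[k] Cochain k A M N n 0 :=
  LinearMap.llcomp k _ _ _ (retractZero e) ∘ₗ LinearMap.lcomp k _ (codiagCoact k A M n) ∘ₗ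
    LinearMap.rTensorHom A

lemma colinearProj_apply (e : N →ₗ[k] N) (n : ℕ) (f : Cochain k A M N n 0) :
    colinearProj e n f = retractZero e ∘ₗ f.rTensor A ∘ₗ codiagCoact k A M n := rfl

section Retract

/-- Only b₀ touches the target, and there A-linearity of the retraction suffices; the other faces
are precompositions. -/
lemma retractHom_dm {k A M N : Type*} [Field k] [Ring A] [Bialgebra k A]
    [AddCommGroup M] [Module k M] [Module A M] [IsScalarTower k A M]
    [AddCommGroup N] [Module k N] [Module A N] [IsScalarTower k A N] [RightComodule k A N]
    {e : N →ₗ[k] N} (he : IsCoinvProj (A := A) e) (n p : ℕ) (f : Cochain k A M N n (p + 1)) :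
    retractHom e (n + 1) p (dm k A M N n (p + 1) f) = dm k A M N n p (retractHom e n p f) := by
  have h1 : retractHom e (n + 1) p (bFirst k A M N n (p + 1) f) =
      bFirst k A M N n p (retractHom e n p f) := by
    refine LinearMap.ext fun z => ?_
    obtain ⟨z, rfl⟩ := (consTensor k A M n).surjective z
    change retractFirst e p _ = _
    rw [bFirst_consTensor, bFirst_consTensor]
    induction z with
    | zero => simp
    | add a b ha hb => simp only [map_add, ha, hb]
    | tmul a z => exact retractFirst_diagAct he p a (f z)
  have h2 : ∀ i : Fin n, retractHom e (n + 1) p (bMid k A M N n (p + 1) i f) =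
      bMid k A M N n p i (retractHom e n p f) := fun i => rfl
  have h3 : retractHom e (n + 1) p (bLast k A M N n (p + 1) f) =
      bLast k A M N n p (retractHom e n p f) := rfl
  simp only [dm, LinearMap.add_apply, LinearMap.sum_apply, LinearMap.smul_apply, map_add, map_sum,
    map_smul, h1, h2, h3]

variable [RightComodule k A N] {e : N →ₗ[k] N}

lemma retractHom_dc_zero (he : IsCoinvProj (A := A) e) (n : ℕ) (f : Cochain k A M N n 0) :
    retractHom e n 0 (dc k A M N n 0 f) = f - colinearProj e n f := by
  have h1 : retractHom e n 0 (cFirst k A M N n 0 f) = f :=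
    LinearMap.ext fun z => retractFirst_coactFirst he 0 (f z)
  have h2 : retractHom e n 0 (cLast k A M N n 0 f) = colinearProj e n f := rfl
  simp [dc, h1, h2, sub_eq_add_neg]

/-- The extra-degeneracy pattern: s c₀ = id and s cᵢ₊₁ = cᵢ s, so the shifted faces return with
opposite signs. -/
lemma retractHom_dc_succ [IsHopfModule k A N] (he : IsCoinvProj (A := A) e) (n p : ℕ)
    (f : Cochain k A M N n (p + 1)) :
    retractHom e n (p + 1) (dc k A M N n (p + 1) f) =
      f - dc k A M N n p (retractHom e n p f) := by
  have h1 : retractHom e n (p + 1) (cFirst k A M N n (p + 1) f) = f :=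
    LinearMap.ext fun z => retractFirst_coactFirst he (p + 1) (f z)
  have h2 : retractHom e n (p + 1) (cMid k A M N n (p + 1) 0 f) =
      cFirst k A M N n p (retractHom e n p f) :=
    LinearMap.ext fun z => retractFirst_comulAt_zero he p (f z)
  have h3 : ∀ i : Fin p, retractHom e n (p + 1) (cMid k A M N n (p + 1) i.succ f) =
      cMid k A M N n p i (retractHom e n p f) := fun i =>
    LinearMap.ext fun z => retractFirst_comulAt_succ e p i (f z)
  have h4 : retractHom e n (p + 1) (cLast k A M N n (p + 1) f) =
      cLast k A M N n p (retractHom e n p f) := by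
    refine LinearMap.ext fun z => ?_
    change retractFirst e (p + 1) (tensorSnoc k A N (p + 1) (f.rTensor A _)) =
      tensorSnoc k A N p ((retractFirst e p ∘ₗ f).rTensor A _)
    rw [retractFirst_tensorSnoc, LinearMap.rTensor_comp_apply]
  simp only [dc, LinearMap.add_apply, LinearMap.sum_apply, LinearMap.smul_apply, map_add, map_sum,
    map_smul, map_neg, Fin.sum_univ_succ, h1, h2, h3, h4, Fin.val_zero, Fin.val_succ, pow_succ,
    mul_neg, mul_one, neg_smul, one_smul, neg_neg, pow_zero, Finset.sum_neg_distrib]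
  abel

variable [Module A M] [IsScalarTower k A M]

/-- For b₀ this is A-linearity of the retraction; the other faces are precompositions with colinear
maps, which π respects. -/
lemma dm_colinearProj [IsHopfModule k A M] (he : IsCoinvProj (A := A) e) (n : ℕ)
    (f : Cochain k A M N n 0) :
    dm k A M N n 0 (colinearProj e n f) = colinearProj e (n + 1) (dm k A M N n 0 f) := by
  have h1 : bFirst k A M N n 0 (colinearProj e n f) =
      colinearProj e (n + 1) (bFirst k A M N n 0 f) := by
    refine LinearMap.ext fun z => ?_
    obtain ⟨z, rfl⟩ := (consTensor k A M n).surjective z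
    have hE := isColinear_consTensor (k := k) (A := A) (M := M) n z
    rw [LinearEquiv.coe_coe] at hE
    have hB : bFirst k A M N n 0 f ∘ₗ (consTensor k A M n).toLinearMap =
        diagAct k A N 0 ∘ₗ f.lTensor A := LinearMap.ext fun z => bFirst_consTensor n 0 f z
    rw [bFirst_consTensor, colinearProj_apply, colinearProj_apply, LinearMap.comp_apply, LinearMap.comp_apply,
      hE, ← LinearMap.rTensor_comp_apply, hB]
    clear hE
    induction z with
    | zero => simp
    | add a b ha hb => simp only [map_add, ha, hb]
    | tmul a z =>
      rw [LinearMap.lTensor_tmul, LinearMap.comp_apply, LinearMap.comp_apply, tensorCoact_tmul]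
      generalize codiagCoact k A M n z = w
      induction w with
      | zero => simp
      | add a b ha hb => simp only [map_add, TensorProduct.tmul_add, ha, hb]
      | tmul z b =>
        rw [LinearMap.rTensor_tmul, ← retractZero_diagAct he]
        generalize (Coalgebra.comul a : A ⊗[k] A) = v
        induction v with
        | zero => simp
        | add a b ha hb => simp only [map_add, TensorProduct.add_tmul, ha, hb]
        | tmul c d => simp
  have key : ∀ g : (⨂[k]^(n + 1) A) ⊗[k] M →ₗ[k] (⨂[k]^n A) ⊗[k] M,
      IsColinear (codiagCoact k A M (n + 1)) (codiagCoact k A M n) g →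
      colinearProj e n f ∘ₗ g = colinearProj e (n + 1) (f ∘ₗ g) := by
    intro g hg
    refine LinearMap.ext fun z => ?_
    simp only [colinearProj_apply, LinearMap.comp_apply, hg z, LinearMap.rTensor_comp_apply]
  have h2 : ∀ i : Fin n, bMid k A M N n 0 i (colinearProj e n f) =
      colinearProj e (n + 1) (bMid k A M N n 0 i f) := fun i => key _ (isColinear_mulAt n i)
  have h3 : bLast k A M N n 0 (colinearProj e n f) =
      colinearProj e (n + 1) (bLast k A M N n 0 f) := key _ (isColinear_actLast n)
  simp only [dm, LinearMap.add_apply, LinearMap.sum_apply, LinearMap.smul_apply, map_add, map_sum,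
    map_smul, h1, h2, h3]

end Retract

section DcProj

variable [RightComodule k A N] [IsHopfModule k A N] {e : N →ₗ[k] N}

/-- At p = 0, being killed by d_c means being colinear. Colinearity of π f combines colinearity of
the retraction with coassociativity on Aⁿ ⊗ M. -/
lemma dc_colinearProj (he : IsCoinvProj (A := A) e) (n : ℕ) (f : Cochain k A M N n 0) :
    dc k A M N n 0 (colinearProj e n f) = 0 := by
  have h : cFirst k A M N n 0 (colinearProj e n f) = cLast k A M N n 0 (colinearProj e n f) := by
    refine LinearMap.ext fun z => ?_
    change coactFirst k A N 0 (retractZero e (f.rTensor A (codiagCoact k A M n z))) =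
      tensorSnoc k A N 0 ((colinearProj e n f).rTensor A (codiagCoact k A M n z))
    rw [coactFirst_retractZero he, colinearProj_apply, LinearMap.rTensor_comp_apply,
      LinearMap.rTensor_comp_apply]
    congr 2
    have hc := (isCoaction_codiagCoact (k := k) (A := A) (M := M) n).coassoc z
    rw [← LinearEquiv.eq_symm_apply] at hc
    rw [hc]
    generalize codiagCoact k A M n z = w
    induction w with
    | zero => simp
    | add a b ha hb => simp only [map_add, ha, hb]
    | tmul x b =>
      simp only [LinearMap.rTensor_tmul, LinearMap.lTensor_tmul]
      generalize (Coalgebra.comul b : A ⊗[k] A) = v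
      induction v with
      | zero => simp
      | add a b ha hb => simp only [map_add, TensorProduct.tmul_add, ha, hb]
      | tmul c d => simp
  simp [dc, h]

end DcProj

section Split

variable [Module A M] [IsScalarTower k A M] {e : M →ₗ[k] M}

/-- An extra degeneracy at the far end: t turns each face except the last into the same-numbered
face after t, while t bₙ₊₂ = id contributes the sign (-1)ⁿ⁺² = (-1)ⁿ. -/
lemma splitHom_dm_succ [IsHopfModule k A M] (he : IsCoinvProj (A := A) e) (n p : ℕ)
    (f : Cochain k A M N (n + 1) p) :
    splitHom e (n + 1) p (dm k A M N (n + 1) p f) =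
      dm k A M N n p (splitHom e n p f) + (-1 : k) ^ n • f := by
  have h1 : splitHom e (n + 1) p (bFirst k A M N (n + 1) p f) =
      bFirst k A M N n p (splitHom e n p f) := by
    refine LinearMap.ext fun z => ?_
    obtain ⟨z, rfl⟩ := (consTensor k A M n).surjective z
    change bFirst k A M N (n + 1) p f (splitLast e (n + 1) _) = _
    rw [bFirst_consTensor]
    induction z with
    | zero => simp
    | add a b ha hb => simp only [map_add, ha, hb]
    | tmul a z => rw [splitLast_consTensor, bFirst_consTensor]; rfl
  have h2 : ∀ i : Fin n, splitHom e (n + 1) p (bMid k A M N (n + 1) p i.castSucc f) =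
      bMid k A M N n p i (splitHom e n p f) := fun i =>
    LinearMap.ext fun z => congrArg f (mulAt_castSucc_splitLast e n i z)
  have h3 : splitHom e (n + 1) p (bMid k A M N (n + 1) p (Fin.last n) f) =
      bLast k A M N n p (splitHom e n p f) :=
    LinearMap.ext fun z => congrArg f (mulAt_last_splitLast he n z)
  have h4 : splitHom e (n + 1) p (bLast k A M N (n + 1) p f) = f :=
    LinearMap.ext fun z => congrArg f (actLast_splitLast he (n + 1) z)
  simp only [dm, LinearMap.add_apply, LinearMap.sum_apply, LinearMap.smul_apply, map_add, map_sum,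
    map_smul, Fin.sum_univ_castSucc, h1, h2, h3, h4, Fin.val_castSucc, Fin.val_last]
  rw [pow_succ (-1 : k) (n + 1), pow_succ (-1 : k) n]
  simp only [mul_neg, mul_one, neg_neg, add_assoc]

end Split

/-- Colinearity of the splitting handles c₁. The case p = 0 is enough, as t is only applied to the
row of colinear maps. -/
lemma splitHom_dc {k A M N : Type*} [Field k] [Ring A] [Bialgebra k A]
    [AddCommGroup M] [Module k M] [Module A M] [IsScalarTower k A M] [RightComodule k A M]
    [AddCommGroup N] [Module k N] [RightComodule k A N] {e : M →ₗ[k] M} (he : IsCoinvProj (A := A) e) (n : ℕ)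
    (f : Cochain k A M N (n + 1) 0) :
    dc k A M N n 0 (splitHom e n 0 f) = splitHom e n 1 (dc k A M N (n + 1) 0 f) := by
  have h1 : cFirst k A M N n 0 (splitHom e n 0 f) =
      splitHom e n 1 (cFirst k A M N (n + 1) 0 f) := rfl
  have h2 : cLast k A M N n 0 (splitHom e n 0 f) =
      splitHom e n 1 (cLast k A M N (n + 1) 0 f) := by
    refine LinearMap.ext fun z => ?_
    change tensorSnoc k A N 0 ((f ∘ₗ splitLast e n).rTensor A (codiagCoact k A M n z)) =
      tensorSnoc k A N 0 (f.rTensor A (codiagCoact k A M (n + 1) (splitLast e n z)))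
    rw [isColinear_splitLast he n z, LinearMap.rTensor_comp_apply]
  simp [dc, h1, h2]

end Homotopies

/-! ### The primitive of a cocycle in the total complex. -/

section Total

variable {k A M N : Type*} [Field k] [Ring A] [Bialgebra k A]
  [AddCommGroup M] [Module k M] [Module A M] [IsScalarTower k A M]
  [RightComodule k A M]
  [AddCommGroup N] [Module k N] [Module A N] [IsScalarTower k A N]
  [RightComodule k A N] [IsHopfModule k A N]

/-- A primitive of a cocycle of the total complex of positive degree. -/
def totPrimitive (e : M →ₗ[k] M) (e' : N →ₗ[k] N) (q : ℕ) (x : Tot k A M N (q + 1)) :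
    Tot k A M N q
  | ⟨(n, 0), h⟩ =>
    (-1 : k) ^ n • retractHom e' n 0 (x ⟨(n, 1), by simp only at h ⊢; omega⟩) +
      (-1 : k) ^ (n + 1) • splitHom e n 0 (colinearProj e' (n + 1)
        (x ⟨(n + 1, 0), by simp only at h ⊢; omega⟩))
  | ⟨(n, p + 1), h⟩ =>
    (-1 : k) ^ n • retractHom e' n (p + 1) (x ⟨(n, p + 2), by simp only at h ⊢; omega⟩)

/-- The correction t π x is again colinear, hence invisible to d_c; it therefore affects only the
components with p = 0. -/
lemma dc_totPrimitive_zero {e : M →ₗ[k] M} (he : IsCoinvProj (A := A) e) {e' : N →ₗ[k] N}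
    (he' : IsCoinvProj (A := A) e') (q : ℕ) (x : Tot k A M N (q + 1)) (n : ℕ) (h : n + 0 = q) :
    dc k A M N n 0 (totPrimitive e e' q x ⟨(n, 0), h⟩) = (-1 : k) ^ n • dc k A M N n 0
      (retractHom e' n 0 (x ⟨(n, 1), by simp only at h ⊢; omega⟩)) := by
  change dc k A M N n 0 ((-1 : k) ^ n • retractHom e' n 0 (x ⟨(n, 1), _⟩) +
    (-1 : k) ^ (n + 1) • splitHom e n 0 (colinearProj e' (n + 1) (x ⟨(n + 1, 0), _⟩))) = _
  rw [map_add, map_smul, map_smul, splitHom_dc he, dc_colinearProj he', map_zero,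
    smul_zero, add_zero]

lemma neg_one_pow_mul_self {k : Type*} [Field k] (n : ℕ) : (-1 : k) ^ n * (-1 : k) ^ n = 1 := by
  rw [← mul_pow]; simp

variable [IsHopfModule k A M]

lemma totD_totPrimitive {e : M →ₗ[k] M} (he : IsCoinvProj (A := A) e) {e' : N →ₗ[k] N}
    (he' : IsCoinvProj (A := A) e') (q : ℕ) (x : Tot k A M N (q + 1))
    (hx : totD k A M N (q + 1) x = 0) : totD k A M N q (totPrimitive e e' q x) = x := by
  -- The cocycle condition splits into its components on the two axes and in the interior, the last
  -- rescaled so that the sign sits on d_m.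
  have hcol : ∀ p (h : 0 + (p + 1) = q + 1 + 1), dc k A M N 0 p (x ⟨(0, p), by simp only; omega⟩) = 0 := by
    intro p h
    have h1 : (0 : Cochain k A M N 0 (p + 1)) +
      ((-1 : k) ^ 0 • dc k A M N 0 p) (x ⟨(0, p), by simp only; omega⟩) = 0 :=
        congrFun hx ⟨(0, p + 1), h⟩
    simpa using h1
  have hrow : ∀ n (h : n + 1 + 0 = q + 1 + 1), dm k A M N n 0 (x ⟨(n, 0), by simp only; omega⟩) = 0 := by
    intro n h
    have h1 : dm k A M N n 0 (x ⟨(n, 0), by simp only; omega⟩) +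
      (0 : Cochain k A M N (n + 1) 0) = 0 := congrFun hx ⟨(n + 1, 0), h⟩
    simpa using h1
  have hmid : ∀ n p (h : n + 1 + (p + 1) = q + 1 + 1),
      (-1 : k) ^ n • dm k A M N n (p + 1) (x ⟨(n, p + 1), by simp only; omega⟩) =
        dc k A M N (n + 1) p (x ⟨(n + 1, p), by simp only; omega⟩) := by
    intro n p h
    have h1 : dm k A M N n (p + 1) (x ⟨(n, p + 1), by simp only; omega⟩) +
      ((-1 : k) ^ (n + 1) • dc k A M N (n + 1) p) (x ⟨(n + 1, p), by simp only; omega⟩) = 0 :=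
        congrFun hx ⟨(n + 1, p + 1), h⟩
    rw [eq_neg_of_add_eq_zero_left h1, LinearMap.smul_apply, smul_neg, smul_smul, pow_succ,
      ← mul_assoc, neg_one_pow_mul_self]
    simp
  funext ⟨⟨n, p⟩, h⟩
  rcases n with _ | n
  · rcases p with _ | p
    · simp at h
    · change (0 : Cochain k A M N 0 (p + 1)) + ((-1 : k) ^ 0 • dc k A M N 0 p)
        (totPrimitive e e' q x ⟨(0, p), by simp only at h ⊢; omega⟩) = _
      have hc := hcol (p + 1) (by simp only at h; omega)
      have ht := retractHom_dc_succ he' 0 p (x ⟨(0, p + 1), h⟩)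
      rw [hc, map_zero] at ht
      -- The definition of the primitive branches at p = 0, but the correction there has zero d_c.
      rcases p with _ | p
      · rw [LinearMap.smul_apply, dc_totPrimitive_zero he he']
        simpa using (sub_eq_zero.mp ht.symm).symm
      · simp only [totPrimitive]
        simpa using (sub_eq_zero.mp ht.symm).symm
  · rcases p with _ | p
    · change dm k A M N n 0 (totPrimitive e e' q x ⟨(n, 0), by simp only at h ⊢; omega⟩) +
        (0 : Cochain k A M N (n + 1) 0) = _
      have hm := hmid n 0 (by simp only at h; omega)
      have hr := hrow (n + 1) (by simp only at h; omega)
      have hs := splitHom_dm_succ he n 0 (colinearProj e' (n + 1) (x ⟨(n + 1, 0), h⟩))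
      -- Since d_m x = 0 in this corner, t d_m π x = t π d_m x = 0, so d_m t π x = -(-1)ⁿ π x.
      rw [dm_colinearProj he', hr, map_zero, map_zero] at hs
      simp only [totPrimitive, map_add, map_smul, ← retractHom_dm he'] at hm ⊢
      -- The s-term gives x - π x, and the correction, with its sign (-1)ⁿ⁺¹, restores π x.
      rw [← map_smul, hm, retractHom_dc_zero he', eq_neg_of_add_eq_zero_left hs.symm, smul_neg,
        smul_smul, pow_succ, mul_assoc, mul_comm (-1 : k), ← mul_assoc, neg_one_pow_mul_self]
      simp
    · change dm k A M N n (p + 1) (totPrimitive e e' q x ⟨(n, p + 1), by simp only at h ⊢; omega⟩) +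
        ((-1 : k) ^ (n + 1) • dc k A M N (n + 1) p)
          (totPrimitive e e' q x ⟨(n + 1, p), by simp only at h ⊢; omega⟩) = _
      have hm := hmid n (p + 1) (by simp only at h; omega)
      have ht := retractHom_dc_succ he' (n + 1) p (x ⟨(n + 1, p + 1), h⟩)
      have h1 : dm k A M N n (p + 1)
          (totPrimitive e e' q x ⟨(n, p + 1), by simp only at h ⊢; omega⟩) =
          retractHom e' (n + 1) (p + 1)
            (dc k A M N (n + 1) (p + 1) (x ⟨(n + 1, p + 1), h⟩)) := by
        simp only [totPrimitive, map_smul, ← retractHom_dm he', ← hm]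
      have h2 : dc k A M N (n + 1) p
          (totPrimitive e e' q x ⟨(n + 1, p), by simp only at h ⊢; omega⟩) =
          (-1 : k) ^ (n + 1) • dc k A M N (n + 1) p
            (retractHom e' (n + 1) p (x ⟨(n + 1, p + 1), h⟩)) := by
        rcases p with _ | p
        · exact dc_totPrimitive_zero he he' q x (n + 1) _
        · simp only [totPrimitive, map_smul]
      -- In the interior the two contributions are s d_c x and d_c s x, whose sum is x.
      rw [h1, LinearMap.smul_apply, h2, smul_smul, neg_one_pow_mul_self, ht]
      simp

end Total

end HopfModuleCohomology

end

theorem mainTheorem4 {k : Type*} [Field k] :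
    (∀ (A : Type*) [Ring A] [Bialgebra k A], HopfModuleCohomology.HasSkewAntipode k A →
      ∀ (M N : Type*)
        [AddCommGroup M] [Module k M] [Module A M] [IsScalarTower k A M]
        [HopfModuleCohomology.RightComodule k A M] [HopfModuleCohomology.IsHopfModule k A M]
        [AddCommGroup N] [Module k N] [Module A N] [IsScalarTower k A N]
        [HopfModuleCohomology.RightComodule k A N] [HopfModuleCohomology.IsHopfModule k A N]
        (n : ℕ), 1 ≤ n → Subsingleton (HopfModuleCohomology.Cohomology k A M N n)) ∧
    (∀ (A : Type*) [Ring A] [HopfAlgebra k A],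
      Function.Bijective (HopfAlgebra.antipode k : A →ₗ[k] A) →
        HopfModuleCohomology.HasSkewAntipode k A) := by
  refine ⟨fun A _ _ hA M N _ _ _ _ _ _ _ _ _ _ _ _ n hn => ?_,
    fun A _ _ h => HopfModuleCohomology.hasSkewAntipode_of_bijective_antipode h⟩
  obtain ⟨e, he⟩ := HopfModuleCohomology.exists_isCoinvProj (M := M) hA
  obtain ⟨e', he'⟩ := HopfModuleCohomology.exists_isCoinvProj (M := N) hA
  -- Writing the degree as q + 1 makes the coboundaries a range rather than the zero submodule.
  obtain ⟨q, rfl⟩ := Nat.exists_eq_add_of_le' hn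
  rw [Submodule.Quotient.subsingleton_iff, eq_top_iff]
  rintro ⟨x, hx⟩ -
  exact ⟨HopfModuleCohomology.totPrimitive e e' q x,
    HopfModuleCohomology.totD_totPrimitive he he' q x hx⟩
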